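/- Consider the following (approximated) model of a RIS-assisted multi-cell downlink. Transmitters (TXs) form a homogeneous Poisson point process of density $\lambda_t>0$ in the plane; the typical user is at the origin. Each TX independently has an assisting RIS with $N\ge 1$ elements, at distance $d_0>0$ from it, with probability $p\in[0,1]$. Let $C_d,C_r>0$, let $\alpha$ be the path loss exponent, $m_h,m_r>0$ the Nakagami parameters, $P$ the transmit power and $\sigma_0^2$ the noise variance, $\gamma_t=P/\sigma_0^2>0$, and for a TX at distance $d$ put $\eta_g(d)=C_d d^{-\alpha}$, $\eta_h(d)=C_r(d_0d)^{-\alpha}$ (the RIS–user distance is identified with the TX–user distance). Parameters. Let $A=\frac{\Gamma(m_h+1/2)}{\Gamma(m_h)}\frac{\Gamma(m_r+1/2)}{\Gamma(m_r)}$, $E_1=NA(m_hm_r)^{-1/2}$, $E_2=N+N(N-1)A^2/(m_hm_r)$, $\kappa_r=E_1^2/(E_2-E_1^2)$, $\omega_r=(E_2-E_1^2)/E_1$, $\mu^g_q=\Gamma(1+q/2)$, $\mu^{\varsigma}_q=\omega_r^q\,\Gamma(q+\kappa_r)/\Gamma(\kappa_r)$, $\beta=\sqrt{C_rd_0^{-\alpha}/C_d}$,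 $$\chi_1=\mu^g_2+2\beta\mu^g_1\mu^\varsigma_1+\beta^2\mu^\varsigma_2,\qquad \chi_2=\mu^g_4+4\beta\mu^g_3\mu^\varsigma_1+6\beta^2\mu^g_2\mu^\varsigma_2+4\beta^3\mu^g_1\mu^\varsigma_3+\beta^4\mu^\varsigma_4,$$ $\bar\chi=(\chi_2-\chi_1^2)/\chi_1$, $\hat\kappa_s$ the positive integer nearest to $\chi_1^2/(\chi_2-\chi_1^2)$, and $e_1=C_d+NC_rd_0^{-\alpha}$. The user is served by the nearest TX, at distance $d_{g,0}$. If that TX has a RIS, the signal power $S_0$ is (conditionally on the locations) gamma distributed with shape $\hat\kappa_s$ and scale $\eta_g(d_{g,0})\bar\chi$; otherwise $S_0=\eta_g(d_{g,0})|g_0|^2$ with $g_0\sim\mathcal{CN}(0,1)$. Every other TX $k$, at distance $d_{g,k}$, contributes the interference power $|\sqrt{\eta_g(d_{g,k})}\,g_k+\sqrt{\eta_h(d_{g,k})}\,I_{r,k}|^2$ if it has a RIS and $|\sqrt{\eta_g(d_{g,k})}\,g_k|^2$ otherwise, with $g_k\sim\mathcal{CN}(0,1)$ and $I_{r,k}\sim\mathcal{CN}(0,N)$.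 All these variables are independent of each other and of the locations. Let $I$ be the sum of the interference powers, and $\gamma_0=S_0/(I+\gamma_t^{-1})$. Let $\alpha=4$. Then for every threshold $\bar\gamma>0$ the coverage probability $P_{c,n}(\bar\gamma)=\mathbb P(\gamma_0>\bar\gamma)$ is $$P_{c,n}(\bar\gamma)=\frac{\pi\lambda_tp}{2}\sum_{i=0}^{\hat\kappa_s-1}\frac{(-1)^i}{i!}\Big[\frac{\partial^i}{\partial s^i}X^+(s)\Big]_{s=1}+\frac{\pi\lambda_t(1-p)}{2}X^*,$$ where $X^+$ is infinitely differentiable at $s=1$ and $$X^+(s)=\frac{\sqrt\pi\exp\!\big(\frac{X_2(s)^2}{4X_1(s)}\big)\operatorname{erfc}\!\big(\frac{X_2(s)}{2\sqrt{X_1(s)}}\big)}{\sqrt{X_1(s)}},\qquad X_1(s)=\frac{\bar\gamma\gamma_t^{-1}}{C_d\bar\chi}s,$$ $$X_2(s)=\pi\lambda_tp\,{}_2F_1\!\Big(1,-\tfrac12;\tfrac12;-\tfrac{e_1\bar\gamma}{C_d\bar\chi}s\Big)+\pi\lambda_t(1-p)\,{}_2F_1\!\Big(1,-\tfrac12;\tfrac12;-\tfrac{\bar\gamma}{\bar\chi}s\Big),$$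 $$X^*=\frac{\sqrt\pi\exp\!\big(\frac{X_4^2}{4X_3}\big)\operatorname{erfc}\!\big(\frac{X_4}{2\sqrt{X_3}}\big)}{\sqrt{X_3}},\qquad X_3=\frac{\bar\gamma\gamma_t^{-1}}{C_d},$$ $$X_4=\pi\lambda_tp\,{}_2F_1\!\Big(1,-\tfrac12;\tfrac12;-\tfrac{e_1\bar\gamma}{C_d}\Big)+\pi\lambda_t(1-p)\,{}_2F_1\!\Big(1,-\tfrac12;\tfrac12;-\bar\gamma\Big),$$ and ${}_2F_1$ is the Gauss hypergeometric function, analytically continued to $(-\infty,1)$. -/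

import Mathlib

open MeasureTheory ProbabilityTheory Set
open scoped ENNReal NNReal

noncomputable section

namespace RISCoverage

/-! ### Special functions -/

/-- The complementary error function `erfc x = (2/√π) ∫_x^∞ exp(-t²) dt`. -/
def erfc (x : ℝ) : ℝ := 2 / √Real.pi * ∫ t in Ioi x, Real.exp (-t ^ 2)

open Classical in
/-- The Gauss hypergeometric function `₂F₁(a, b; c; z)` for real `z < 1`: the (unique) real-analytic
function on `(-∞, 1)` which on `(-1, 1)` is the sum of the hypergeometric series.  (Mathlib's
`₂F₁` is the sum of the series only, hence meaningless for `z < -1`.) -/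
def hyp2F1 (a b c z : ℝ) : ℝ :=
  if h : ∃ f : ℝ → ℝ, AnalyticOnNhd ℝ f (Iio 1) ∧
      EqOn f (ordinaryHypergeometric a b c : ℝ → ℝ) (Ioo (-1) 1)
  then h.choose z else 0

/-! ### Poisson point processes -/

/-- The plane, with its Euclidean norm. -/
abbrev Plane : Type := EuclideanSpace ℝ (Fin 2)

/-- Number of points of the enumerated point configuration `Φ` that lie in `B`. -/
def count {Ω E : Type*} (Φ : ℕ → Ω → E) (B : Set E) (ω : Ω) : ℕ∞ :=
  {k | Φ k ω ∈ B}.encard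

/-- `Φ 0, Φ 1, …` is a measurable enumeration of the points of a Poisson point process with
intensity measure `Λ`: the counts of sets of finite intensity are Poisson distributed, and the
counts of finitely many pairwise disjoint such sets are independent. -/
structure IsPoissonProcess {Ω E : Type*} [MeasurableSpace Ω] [MeasurableSpace E]
    (Λ : Measure E) (Φ : ℕ → Ω → E) (Pr : Measure Ω) : Prop where
  measurable : ∀ k, Measurable (Φ k)
  hasLaw_count : ∀ B, MeasurableSet B → Λ B < ∞ →
    HasLaw (count Φ B) ((poissonMeasure (Λ B).toNNReal).map (Nat.cast : ℕ → ℕ∞)) Pr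
  iIndepFun_count : ∀ (n : ℕ) (B : Fin n → Set E), (∀ i, MeasurableSet (B i)) →
    (∀ i, Λ (B i) < ∞) → (∀ i j, i ≠ j → Disjoint (B i) (B j)) →
    iIndepFun (fun i => count Φ (B i)) Pr

/-- The circularly symmetric complex Gaussian distribution `𝒞𝒩(0, v)`: independent real and
imaginary parts, each centred Gaussian of variance `v / 2`. -/
def complexGaussian (v : ℝ≥0) : Measure ℂ :=
  ((gaussianReal 0 (v / 2)).prod (gaussianReal 0 (v / 2))).map (fun x => (⟨x.1, x.2⟩ : ℂ))

/-! ### Parameters of the network -/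

/-- Parameters of a RIS-assisted multi-cell network. -/
structure Params where
  /-- density of the transmitters -/
  lam : ℝ
  /-- probability that a transmitter has an assisting RIS -/
  p : ℝ
  /-- distance between a transmitter and its RIS -/
  d₀ : ℝ
  /-- number of elements of a RIS -/
  N : ℕ
  /-- Nakagami shape parameter of the transmitter-RIS channels -/
  mh : ℝ
  /-- Nakagami shape parameter of the RIS-user channels -/
  mr : ℝ
  /-- path loss per unit distance of the direct link -/
  Cd : ℝ
  /-- path loss per unit distance of the reflected link -/
  Cr : ℝ
  /-- path loss exponent -/
  α : ℝ
  /-- transmit power -/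
  P : ℝ
  /-- noise variance `σ₀²` -/
  noise : ℝ
  lam_pos : 0 < lam
  p_mem : p ∈ Icc (0 : ℝ) 1
  d₀_pos : 0 < d₀
  N_pos : 0 < N
  mh_pos : 0 < mh
  mr_pos : 0 < mr
  Cd_pos : 0 < Cd
  Cr_pos : 0 < Cr
  P_pos : 0 < P
  noise_pos : 0 < noise

namespace Params

variable (c : Params)

/-- Transmit signal-to-noise ratio `γ_t = P / σ₀²`. -/
def γt : ℝ := c.P / c.noise

/-- Path loss of a direct link of length `d`. -/
def etaG (d : ℝ) : ℝ := c.Cd * d ^ (-c.α)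

/-- Path loss of a reflected link whose RIS is at distance `dr` from the user. -/
def etaH (dr : ℝ) : ℝ := c.Cr * (c.d₀ * dr) ^ (-c.α)

/-- `e₁ = C_d + N C_r d₀^{-α}`. -/
def e₁ : ℝ := c.Cd + c.N * c.Cr * c.d₀ ^ (-c.α)

/-- `E[S_r]` for `S_r = ∑ₙ |hₙ| |rₙ|` with independent Nakagami factors. -/
def meanSr : ℝ :=
  c.N * (Real.Gamma (c.mh + 1 / 2) / Real.Gamma c.mh) *
    (Real.Gamma (c.mr + 1 / 2) / Real.Gamma c.mr) * √(1 / (c.mh * c.mr))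

/-- `E[S_r²]`. -/
def secondMomentSr : ℝ :=
  c.N + c.N * (c.N - 1) * ((Real.Gamma (c.mh + 1 / 2) / Real.Gamma c.mh) *
    (Real.Gamma (c.mr + 1 / 2) / Real.Gamma c.mr)) ^ 2 * (1 / (c.mh * c.mr))

/-- Shape of the gamma variable matching the first two moments of `S_r`. -/
def κr : ℝ := c.meanSr ^ 2 / (c.secondMomentSr - c.meanSr ^ 2)

/-- Scale of the gamma variable matching the first two moments of `S_r`. -/
def ωr : ℝ := (c.secondMomentSr - c.meanSr ^ 2) / c.meanSr

/-- `q`-th raw moment of the Rayleigh variable `|g₀|`. -/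
def μg (q : ℕ) : ℝ := Real.Gamma (1 + q / 2)

/-- `q`-th raw moment of the gamma variable with shape `κ_r` and scale `ω_r`. -/
def μς (q : ℕ) : ℝ := c.ωr ^ q * (Real.Gamma (q + c.κr) / Real.Gamma c.κr)

/-- The ratio `β = √(η_h / η_g)`, in which the RIS-user distance is identified with the
transmitter-user distance (see `beta_eq`). -/
def β : ℝ := √(c.Cr * c.d₀ ^ (-c.α) / c.Cd)

theorem beta_eq (d : ℝ) (hd : 0 < d) : √(c.etaH d / c.etaG d) = c.β := by
  have h := (Real.rpow_pos_of_pos hd (-c.α)).ne'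
  unfold etaH etaG β
  rw [Real.mul_rpow c.d₀_pos.le hd.le, ← mul_assoc, mul_div_mul_right _ _ h]

/-- First moment of `(|g₀| + β S_r)²`. -/
def χ₁ : ℝ := μg 2 + 2 * c.β * μg 1 * c.μς 1 + c.β ^ 2 * c.μς 2

/-- Second moment of `(|g₀| + β S_r)²`. -/
def χ₂ : ℝ :=
  μg 4 + 4 * c.β * μg 3 * c.μς 1 + 6 * c.β ^ 2 * μg 2 * c.μς 2
    + 4 * c.β ^ 3 * μg 1 * c.μς 3 + c.β ^ 4 * c.μς 4

/-- Shape of the gamma variable matching the first two moments of the signal power `S₀⁺`. -/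
def κs : ℝ := c.χ₁ ^ 2 / (c.χ₂ - c.χ₁ ^ 2)

/-- The positive integer nearest to `κ_s`. -/
def κhat : ℕ := max 1 (round c.κs).toNat

/-- `χ̄ = (χ₂ - χ₁²) / χ₁`. -/
def χbar : ℝ := (c.χ₂ - c.χ₁ ^ 2) / c.χ₁

/-- Scale `ω_s` of the gamma variable matching the first two moments of `S₀⁺` when the serving
transmitter is at distance `d`. -/
def ωs (d : ℝ) : ℝ := c.etaG d * c.χbar

/-! ### The network -/

/-- The mark `(b, g, Ir, G)` of a transmitter: whether it has a RIS; the fading of its direct link;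
the sum `∑ₙ |hₙ| |rₙ| e^{jθₙ}` over its RIS as an interferer; the normalised (unit scale) signal
power it delivers when it has a RIS and serves the user. -/
abbrev Mark : Type := Bool × ℂ × ℂ × ℝ

/-- Law of a mark: Bernoulli(`p`), `𝒞𝒩(0, 1)`, `𝒞𝒩(0, N)`, Gamma(`κ̂_s`, 1), independent. -/
def markLaw : Measure Mark :=
  (bernoulliMeasure true false ⟨c.p, c.p_mem⟩).prod
    ((complexGaussian 1).prod ((complexGaussian c.N).prod (gammaMeasure c.κhat 1)))

/-- Received signal power when the serving transmitter is at distance `d` and has mark `m`: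
Gamma(`κ̂_s`, scale `ω_s`) distributed with a RIS, `η_g |g|²` without. -/
def signal (d : ℝ) (m : Mark) : ℝ :=
  if m.1 then c.ωs d * m.2.2.2 else c.etaG d * ‖m.2.1‖ ^ 2

/-- Interference power of a transmitter at distance `d` with mark `m`. -/
def interference (d : ℝ) (m : Mark) : ℝ :=
  if m.1 then ‖((√(c.etaG d) : ℝ) : ℂ) * m.2.1 + ((√(c.etaH d) : ℝ) : ℂ) * m.2.2.1‖ ^ 2
  else ‖((√(c.etaG d) : ℝ) : ℂ) * m.2.1‖ ^ 2

/-- The transmitters `Φ k` form a homogeneous Poisson process of density `λ_t` in the plane and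
carry independent identically distributed marks `M k` that are independent of the locations. -/
structure IsNetwork {Ω : Type*} [MeasurableSpace Ω] (Φ : ℕ → Ω → Plane) (M : ℕ → Ω → Mark)
    (Pr : Measure Ω) : Prop where
  poisson : IsPoissonProcess (ENNReal.ofReal c.lam • volume) Φ Pr
  hasLaw_mark : ∀ k, HasLaw (M k) c.markLaw Pr
  iIndepFun_mark : iIndepFun M Pr
  indepFun : IndepFun (fun ω k => Φ k ω) (fun ω k => M k ω) Pr

variable {Ω : Type*} (Φ : ℕ → Ω → Plane) (M : ℕ → Ω → Mark)

/-- Index of the transmitter nearest to the user, who is at the origin (almost surely there is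
exactly one). -/
def nearest (ω : Ω) : ℕ := sInf {k | ∀ j, ‖Φ k ω‖ ≤ ‖Φ j ω‖}

/-- Total interference power from all the transmitters but the serving (nearest) one. -/
def totalInterference (ω : Ω) : ℝ≥0∞ :=
  ∑' k, if k = nearest Φ ω then 0 else ENNReal.ofReal (c.interference ‖Φ k ω‖ (M k ω))

/-- The SINR `γ₀ = S₀ / (I + γ_t⁻¹)` with the nearest association strategy. -/
def sinr (ω : Ω) : ℝ≥0∞ :=
  ENNReal.ofReal (c.signal ‖Φ (nearest Φ ω) ω‖ (M (nearest Φ ω) ω)) /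
    (c.totalInterference Φ M ω + ENNReal.ofReal c.γt⁻¹)

/-- The coverage probability `P_{c,n}(γ)`, the probability that `γ₀ > γ`. -/
def coverage [MeasurableSpace Ω] (Pr : Measure Ω) (γ : ℝ) : ℝ :=
  Pr.real {ω | ENNReal.ofReal γ < c.sinr Φ M ω}

/-! ### The terms of the closed form -/

/-- `√π exp(y² / (4x)) erfc(y / (2√x)) / √x`. -/
def erfcTerm (x y : ℝ) : ℝ :=
  √Real.pi * Real.exp (y ^ 2 / (4 * x)) * erfc (y / (2 * √x)) / √x

/-- `X₁(s)`. -/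
def X₁ (γ s : ℝ) : ℝ := γ * c.γt⁻¹ / (c.Cd * c.χbar) * s

/-- `X₂(s)`. -/
def X₂ (γ s : ℝ) : ℝ :=
  Real.pi * c.lam * c.p * hyp2F1 1 (-1 / 2) (1 / 2) (-(c.e₁ * γ / (c.Cd * c.χbar) * s)) +
    Real.pi * c.lam * (1 - c.p) * hyp2F1 1 (-1 / 2) (1 / 2) (-(γ / c.χbar * s))

/-- `X⁺(s)`. -/
def Xplus (γ s : ℝ) : ℝ := erfcTerm (c.X₁ γ s) (c.X₂ γ s)

/-- `X₃`. -/
def X₃ (γ : ℝ) : ℝ := γ * c.γt⁻¹ / c.Cd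

/-- `X₄`. -/
def X₄ (γ : ℝ) : ℝ :=
  Real.pi * c.lam * c.p * hyp2F1 1 (-1 / 2) (1 / 2) (-(c.e₁ * γ / c.Cd)) +
    Real.pi * c.lam * (1 - c.p) * hyp2F1 1 (-1 / 2) (1 / 2) (-γ)

/-- `X*`. -/
def Xstar (γ : ℝ) : ℝ := erfcTerm (c.X₃ γ) (c.X₄ γ)

end Params

end RISCoverage

end

/-! Let `d` be the serving distance and `D = I + γ_t⁻¹`. Given the locations and `D`, a server
without RIS covers the user with probability `exp (-γ D / η_g(d))`. With a RIS, put `T = γ D / (χ̄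
η_g(d))`: the gamma shape is an integer, so the probability is `∑_{i < κ̂_s} T^i e^{-T} / i!`. Since
`E[T^i e^{-T}]` is `(-1)^i` times the `i`-th derivative of `s ↦ E[e^{-sT}]` at `1`
(`laplace_derivatives`, which also gives the smoothness of `X⁺`), everything reduces to the single
transform `E exp (-b D / η_g(d))`, taken at `b = γ` and at `b = s γ / χ̄`
(`IsNetwork.lintegral_noisyInterference`).

To compute it, pass to `U_k = L ‖Φ_k‖²` with `L = π λ_t`, a unit rate Poisson process on the
half-line. For `α = 4` all path gains are proportional to `U⁻²`, so averaging the fading of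
interferer `k` leaves `V (U* / U_k)`, where `U*` is the smallest point, `V t = p / (1 + y t²) + (1 -
p) / (1 + b t²)` and `y = b e₁ / C_d`; the noise contributes a factor `w (U*)` that is Gaussian in
`U*`. The key formula (`lintegral_nearest`) is `E[w(U*) ∏ V(U*/U_k)] = ∫₀^∞ w(u) e^{-u} exp (-∫_u^∞
(1 - V(u/x)) dx) du`. By scaling, the inner integral is linear in `u`, with slope `p √y arctan √y +
(1 - p) √b arctan √b`, and `1 + √y arctan √y = ₂F₁(1, -1/2; 1/2; -y)` (`hyp2F1_neg`). What remains
is the exponential of a quadratic on the half-line, whence `erfc` (`integral_Ioi_exp_quadratic`).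

The process is known only through its counts in disjoint sets, so the key formula is proved by
discretisation: on a dyadic grid the functional becomes a finite sum of products of functions of
independent Poisson counts, whose mean is explicit, and both sides converge as the mesh shrinks.
Values are kept in `[0, ∞]` with `exp (-∞) = 0`, so the interference need not be shown finite. -/

noncomputable section

namespace RISCoverage

open Filter Topology

/-! ### Special functions -/

/-- The Gauss hypergeometric function `₂F₁(1, -1/2; 1/2; z)`: its series, glued to its closed form on the
negative half-line. -/
def hypGlued (z : ℝ) : ℝ :=
  if z < 0 then 1 + √(-z) * Real.arctan √(-z)
  else ordinaryHypergeometric (1 : ℝ) (-1 / 2 : ℝ) (1 / 2 : ℝ) z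

/-- The quotient of rising factorials `(-1/2)_n / (1/2)_n` telescopes to `(-1/2) / (n - 1/2)`, and
`(1)_n` cancels `n!`. -/
theorem hyp_coefficient (n : ℕ) :
    ordinaryHypergeometricCoefficient (1 : ℝ) (-1 / 2) (1 / 2) n = -1 / (2 * n - 1) := by
  unfold ordinaryHypergeometricCoefficient
  have h1 : (ascPochhammer ℝ n).eval 1 = n.factorial := ascPochhammer_eval_one ℝ n
  have hpos : ∀ n : ℕ, 0 < (ascPochhammer ℝ n).eval (1 / 2) := fun n =>
    ascPochhammer_pos n _ (by norm_num)
  have h2 : ∀ n : ℕ, (ascPochhammer ℝ n).eval (-1 / 2) * (2 * n - 1) =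
      - (ascPochhammer ℝ n).eval (1 / 2) := by
    intro n
    induction n with
    | zero => simp
    | succ n ih =>
      rw [ascPochhammer_succ_eval, ascPochhammer_succ_eval]
      push_cast
      linear_combination (n + 1 / 2 : ℝ) * ih
  have h3 : (2 * n - 1 : ℝ) ≠ 0 := by
    intro h
    have h' : (2 * n : ℝ) = 1 := by linarith
    have : 2 * n = 1 := by exact_mod_cast h'
    omega
  have hf : (n.factorial : ℝ) ≠ 0 := by positivity
  rw [h1, inv_mul_cancel₀ hf, one_mul, eq_div_iff h3, mul_right_comm, h2 n, neg_mul,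
    mul_inv_cancel₀ (hpos n).ne']

theorem hyp_eq_arctan {y : ℝ} (h0 : 0 ≤ y) (h1 : y < 1) :
    ordinaryHypergeometric (1 : ℝ) (-1 / 2 : ℝ) (1 / 2 : ℝ) (-y) = 1 + √y * Real.arctan √y := by
  have hs : ‖√y‖ < 1 := by
    rw [Real.norm_of_nonneg (Real.sqrt_nonneg y), Real.sqrt_lt' one_pos]
    simpa using h1
  have h := (Real.hasSum_arctan hs).mul_left √y
  have key : HasSum (fun n : ℕ => ordinaryHypergeometricCoefficient (1 : ℝ) (-1 / 2) (1 / 2) n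
      • (-y) ^ n) (1 + √y * Real.arctan √y) := by
    -- The constant term is `1`; the shifted series is `√y` times the Taylor series of `arctan` at
    -- `√y`.
    rw [← hasSum_nat_add_iff' 1]
    simp only [hyp_coefficient]
    convert! h using 1
    · funext n
      have : √y * ((-1) ^ n * √y ^ (2 * n + 1) / ((2 * n + 1 : ℕ) : ℝ))
        = (-1) ^ n * (√y ^ 2) ^ (n + 1) / ((2 * n + 1 : ℕ) : ℝ) := by ring
      rw [this, Real.sq_sqrt h0, neg_pow y, smul_eq_mul]
      push_cast
      have : (2 * (n + 1 : ℝ) - 1) = 2 * n + 1 := by ring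
      rw [this]
      ring
    · simp
  unfold ordinaryHypergeometric
  rw [ordinaryHypergeometric_sum_eq]
  exact key.tsum_eq

theorem hypGlued_eqOn :
    EqOn hypGlued (ordinaryHypergeometric (1 : ℝ) (-1 / 2 : ℝ) (1 / 2 : ℝ) : ℝ → ℝ) (Ioo (-1) 1) := by
  intro z hz
  unfold hypGlued
  split_ifs with h
  · have := hyp_eq_arctan (y := -z) (by linarith) (by linarith [hz.1])
    rw [neg_neg] at this
    exact this.symm
  · rfl

theorem analyticOnNhd_hypGlued : AnalyticOnNhd ℝ hypGlued (Iio 1) := by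
  intro z hz
  -- The closed form is singular at `0` because of `√`; there the power series takes over, valid on
  -- all of `(-1, 1)`.
  by_cases hz' : z < 0
  · have h : AnalyticAt ℝ (fun z : ℝ => 1 + √(-z) * Real.arctan √(-z)) z := by
      apply ContDiffAt.analyticAt
      have hs : ContDiffAt ℝ ⊤ (fun z : ℝ => √(-z)) z :=
        (Real.contDiffAt_sqrt (by linarith : -z ≠ 0)).comp z contDiffAt_id.neg
      exact contDiffAt_const.add (hs.mul (Real.contDiff_arctan.contDiffAt.comp z hs))
    refine h.congr ?_
    filter_upwards [Iio_mem_nhds hz'] with w hw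
    simp only [hypGlued, if_pos (show w < 0 from hw)]
  · have hz1 : z ∈ Ioo (-1 : ℝ) 1 := ⟨by linarith [not_lt.1 hz'], hz⟩
    have hr := ordinaryHypergeometricSeries_radius_eq_one (𝔸 := ℝ) (1 : ℝ) (-1 / 2 : ℝ) (1 / 2 : ℝ) (by
      intro k
      refine ⟨?_, ?_, ?_⟩
      · have : (0 : ℝ) ≤ k := by positivity
        linarith
      · intro h
        have h' : (2 * k : ℝ) = 1 := by linarith
        have : 2 * k = 1 := by exact_mod_cast h'
        omega
      · have : (0 : ℝ) ≤ k := by positivity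
        linarith)
    have hb := (ordinaryHypergeometricSeries ℝ (1 : ℝ) (-1 / 2 : ℝ) (1 / 2 : ℝ)).hasFPowerSeriesOnBall
      (by rw [hr]; exact one_pos)
    have ha := hb.analyticAt_of_mem (y := z) (by
      rw [hr]
      simp only [Metric.mem_eball, edist_dist, dist_zero_right]
      rw [show (1 : ℝ≥0∞) = ENNReal.ofReal 1 by simp]
      exact (ENNReal.ofReal_lt_ofReal_iff one_pos).2 (by rw [Real.norm_eq_abs, abs_lt]; exact hz1))
    refine AnalyticAt.congr ha ?_
    filter_upwards [isOpen_Ioo.mem_nhds hz1] with w hw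
    exact (hypGlued_eqOn hw).symm

/-- Closed form of `₂F₁(1, -1/2; 1/2; ·)` on the negative half-line. -/
theorem hyp2F1_neg {y : ℝ} (hy : 0 < y) :
    hyp2F1 1 (-1 / 2) (1 / 2) (-y) = 1 + √y * Real.arctan √y := by
  have hex : ∃ f : ℝ → ℝ, AnalyticOnNhd ℝ f (Iio 1) ∧
      EqOn f (ordinaryHypergeometric (1 : ℝ) (-1 / 2 : ℝ) (1 / 2 : ℝ) : ℝ → ℝ) (Ioo (-1) 1) :=
    ⟨hypGlued, analyticOnNhd_hypGlued, hypGlued_eqOn⟩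
  have h1 : hyp2F1 1 (-1 / 2) (1 / 2) (-y) = hex.choose (-y) := by
    unfold hyp2F1
    rw [dif_pos hex]
  -- The chosen continuation is opaque; the identity theorem on the connected set `(-∞, 1)`
  -- identifies it.
  have h2 : EqOn hex.choose hypGlued (Iio 1) := by
    refine hex.choose_spec.1.eqOn_of_preconnected_of_eventuallyEq analyticOnNhd_hypGlued
      isPreconnected_Iio (z₀ := 0) (by simp) ?_
    filter_upwards [isOpen_Ioo.mem_nhds (show (0 : ℝ) ∈ Ioo (-1 : ℝ) 1 by simp)] with w hw
    rw [hex.choose_spec.2 hw, hypGlued_eqOn hw]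
  rw [h1, h2 (show -y ∈ Iio (1 : ℝ) by simp; linarith)]
  simp [hypGlued, hy]

theorem integral_Ioi_exp_quadratic {x : ℝ} (hx : 0 < x) (y : ℝ) :
    ∫ t in Ioi (0 : ℝ), Real.exp (-(x * t ^ 2 + y * t)) = Params.erfcTerm x y / 2 := by
  have hs : 0 < √x := Real.sqrt_pos.2 hx
  -- Completing the square.
  have h1 : ∀ t, Real.exp (-(x * t ^ 2 + y * t)) =
      Real.exp (y ^ 2 / (4 * x)) * Real.exp (-(√x * (t + y / (2 * x))) ^ 2) := by
    intro t
    rw [← Real.exp_add, mul_pow, Real.sq_sqrt hx.le]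
    congr 1
    field_simp
    ring
  simp_rw [h1]
  rw [integral_const_mul]
  have h2 : ∫ t in Ioi (0 : ℝ), Real.exp (-(√x * (t + y / (2 * x))) ^ 2) =
      ∫ t in Ioi (y / (2 * x)), Real.exp (-(√x * t) ^ 2) := by
    have := (measurePreserving_add_right volume (y / (2 * x))).setIntegral_preimage_emb
      (measurableEmbedding_addRight _) (fun t => Real.exp (-(√x * t) ^ 2)) (Ioi (y / (2 * x)))
    simpa using this
  rw [h2, integral_comp_mul_left_Ioi (fun t => Real.exp (-t ^ 2)) _ hs]
  have h3 : √x * (y / (2 * x)) = y / (2 * √x) := by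
    field_simp
    rw [Real.sq_sqrt hx.le, mul_comm]
  rw [h3]
  unfold Params.erfcTerm erfc
  have hp : √Real.pi ≠ 0 := (Real.sqrt_pos.2 Real.pi_pos).ne'
  rw [smul_eq_mul]
  field_simp

/-- `∫₁^∞ y / (x² + y) dx = √y arctan √y`. -/
theorem integral_Ioi_one_div {y : ℝ} (hy : 0 < y) :
    IntegrableOn (fun x : ℝ => y / (x ^ 2 + y)) (Ioi 1) ∧
    ∫ x in Ioi (1 : ℝ), y / (x ^ 2 + y) = √y * Real.arctan √y := by
  have hs : 0 < √y := Real.sqrt_pos.2 hy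
  have hd : ∀ x ∈ Ici (1 : ℝ), HasDerivAt (fun x => √y * Real.arctan (x / √y)) (y / (x ^ 2 + y)) x := by
    intro x _
    have h := ((hasDerivAt_id x).div_const √y).arctan.const_mul √y
    convert! h using 1
    simp only [id, div_pow, Real.sq_sqrt hy.le]
    field_simp
    ring
  have hlim : Tendsto (fun x => √y * Real.arctan (x / √y)) atTop (𝓝 (√y * (Real.pi / 2))) := by
    refine Tendsto.const_mul _ ?_
    exact ((Real.tendsto_arctan_atTop.mono_right nhdsWithin_le_nhds).comp
      (tendsto_id.atTop_div_const hs))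
  have hint := integrableOn_Ioi_deriv_of_nonneg' hd (fun x _ => by positivity) hlim
  refine ⟨hint, ?_⟩
  rw [integral_Ioi_of_hasDerivAt_of_tendsto' hd hint hlim]
  rw [one_div, Real.arctan_inv_of_pos hs]
  ring

/-! ### Positivity of the fitted parameters -/

/-- Strict Cauchy–Schwarz, `Γ(m + 1/2)² < Γ(m) Γ(m + 1)`, in discriminant form: the quadratic in `t`
below is the integral of `(t √x - 1)²` against the gamma density, hence positive. It makes the
variance of `S_r` positive. -/
theorem Gamma_add_half_sq_lt {m : ℝ} (hm : 0 < m) :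
    (Real.Gamma (m + 1 / 2) / Real.Gamma m) ^ 2 < m := by
  have hG : 0 < Real.Gamma m := Real.Gamma_pos_of_pos hm
  have hG1 : Real.Gamma (m + 1) = m * Real.Gamma m := Real.Gamma_add_one hm.ne'
  set B := Real.Gamma (m + 1 / 2) with hB
  have hGi : ∀ {s : ℝ}, 0 < s → IntegrableOn (fun x : ℝ => Real.exp (-x) * x ^ (s - 1)) (Ioi 0) :=
    fun hs => Real.GammaIntegral_convergent hs
  have hpos : ∀ t : ℝ, 0 < t ^ 2 * Real.Gamma (m + 1) - 2 * t * B + Real.Gamma m := by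
    intro t
    have heq : t ^ 2 * Real.Gamma (m + 1) - 2 * t * B + Real.Gamma m =
        ∫ x in Ioi (0 : ℝ), Real.exp (-x) * x ^ (m - 1) * (t * √x - 1) ^ 2 := by
      rw [hB, Real.Gamma_eq_integral (by linarith : 0 < m + 1),
        Real.Gamma_eq_integral (by linarith : 0 < m + 1 / 2), Real.Gamma_eq_integral hm,
        ← integral_const_mul, ← integral_const_mul, ← integral_sub, ← integral_add]
      · refine setIntegral_congr_fun measurableSet_Ioi fun x hx => ?_
        have hx : 0 < x := hx
        have e1 : x ^ (m + 1 - 1) = x ^ (m - 1) * √x ^ 2 := by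
          rw [Real.sq_sqrt hx.le]
          nth_rewrite 3 [← Real.rpow_one x]
          rw [← Real.rpow_add hx]
          congr 1; ring
        have e2 : x ^ (m + 1 / 2 - 1) = x ^ (m - 1) * √x := by
          rw [Real.sqrt_eq_rpow, ← Real.rpow_add hx]
          congr 1; ring
        simp only [e1, e2]
        ring
      · exact ((hGi (by linarith)).const_mul _).sub ((hGi (by linarith)).const_mul _)
      · exact hGi hm
      · exact (hGi (by linarith)).const_mul _
      · exact (hGi (by linarith)).const_mul _
    rw [heq]
    have hint : IntegrableOn (fun x : ℝ => Real.exp (-x) * x ^ (m - 1) * (t * √x - 1) ^ 2) (Ioi 0) := by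
      have : IntegrableOn (fun x : ℝ => t ^ 2 * (Real.exp (-x) * x ^ (m + 1 - 1)) -
          2 * t * (Real.exp (-x) * x ^ (m + 1 / 2 - 1)) + Real.exp (-x) * x ^ (m - 1)) (Ioi 0) :=
        (((hGi (by linarith)).const_mul _).sub ((hGi (by linarith)).const_mul _)).add (hGi hm)
      refine this.congr_fun (fun x hx => ?_) measurableSet_Ioi
      have hx : 0 < x := hx
      have e1 : x ^ (m + 1 - 1) = x ^ (m - 1) * √x ^ 2 := by
        rw [Real.sq_sqrt hx.le]
        nth_rewrite 3 [← Real.rpow_one x]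
        rw [← Real.rpow_add hx]
        congr 1; ring
      have e2 : x ^ (m + 1 / 2 - 1) = x ^ (m - 1) * √x := by
        rw [Real.sqrt_eq_rpow, ← Real.rpow_add hx]
        congr 1; ring
      simp only [e1, e2]
      ring
    rw [setIntegral_pos_iff_support_of_nonneg_ae _ hint]
    · have hsub : Ioi (0 : ℝ) \ {(1 / t) ^ 2} ⊆
          Function.support (fun x : ℝ => Real.exp (-x) * x ^ (m - 1) * (t * √x - 1) ^ 2) ∩ Ioi 0 := by
        rintro x ⟨hx, hne⟩
        have hx : 0 < x := hx
        refine ⟨?_, hx⟩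
        have h1 : t * √x - 1 ≠ 0 := by
          intro h
          apply hne
          have ht : t ≠ 0 := by rintro rfl; simp at h
          have : √x = 1 / t := by field_simp; linarith
          rw [mem_singleton_iff, ← this, Real.sq_sqrt hx.le]
        have h2 := Real.rpow_pos_of_pos hx (m - 1)
        exact (by positivity : 0 < Real.exp (-x) * x ^ (m - 1) * (t * √x - 1) ^ 2).ne'
      refine lt_of_lt_of_le ?_ (measure_mono hsub)
      rw [measure_sdiff_null (by simp)]
      simp
    · filter_upwards [ae_restrict_mem measurableSet_Ioi] with x hx
      have h2 := Real.rpow_pos_of_pos hx (m - 1)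
      simp only [Pi.zero_apply]
      positivity
  -- The minimiser of the quadratic.
  have h := hpos (B / (m * Real.Gamma m))
  rw [hG1] at h
  rw [div_pow, div_lt_iff₀ (by positivity)]
  have h2 : (B / (m * Real.Gamma m)) ^ 2 * (m * Real.Gamma m) - 2 * (B / (m * Real.Gamma m)) * B
      + Real.Gamma m = (m * Real.Gamma m ^ 2 - B ^ 2) / (m * Real.Gamma m) := by
    field_simp
    ring
  rw [h2] at h
  have h3 := (div_pos_iff_of_pos_right (by positivity)).1 h
  linarith

theorem Gamma_three_half : Real.Gamma (3 / 2) = √Real.pi / 2 := by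
  rw [show (3 / 2 : ℝ) = 1 / 2 + 1 by norm_num, Real.Gamma_add_one (by norm_num),
    Real.Gamma_one_half_eq]
  ring

theorem Gamma_five_half : Real.Gamma (5 / 2) = 3 / 2 * (√Real.pi / 2) := by
  rw [show (5 / 2 : ℝ) = 3 / 2 + 1 by norm_num, Real.Gamma_add_one (by norm_num),
    Gamma_three_half]

namespace Params

variable (c : Params)

theorem meanSr_pos : 0 < c.meanSr := by
  have := c.mh_pos
  have := c.mr_pos
  have hN : (0 : ℝ) < c.N := by exact_mod_cast c.N_pos
  have h1 := Real.Gamma_pos_of_pos c.mh_pos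
  have h2 := Real.Gamma_pos_of_pos c.mr_pos
  have h3 := Real.Gamma_pos_of_pos (by linarith : 0 < c.mh + 1 / 2)
  have h4 := Real.Gamma_pos_of_pos (by linarith : 0 < c.mr + 1 / 2)
  unfold meanSr
  positivity

theorem variance_Sr_pos : 0 < c.secondMomentSr - c.meanSr ^ 2 := by
  have hh := c.mh_pos
  have hr := c.mr_pos
  have hN : (0 : ℝ) < c.N := by exact_mod_cast c.N_pos
  have h1 := Gamma_add_half_sq_lt hh
  have h2 := Gamma_add_half_sq_lt hr
  unfold meanSr secondMomentSr
  set a := Real.Gamma (c.mh + 1 / 2) / Real.Gamma c.mh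
  set b := Real.Gamma (c.mr + 1 / 2) / Real.Gamma c.mr
  have h3 : a ^ 2 * b ^ 2 < c.mh * c.mr :=
    mul_lt_mul'' h1 h2 (sq_nonneg _) (sq_nonneg _)
  have h4 : a ^ 2 * b ^ 2 * (1 / (c.mh * c.mr)) < 1 := by
    rw [mul_one_div, div_lt_one (by positivity)]
    exact h3
  rw [mul_pow (c.N * a * b), Real.sq_sqrt (by positivity)]
  have : (c.N + c.N * (c.N - 1) * (a * b) ^ 2 * (1 / (c.mh * c.mr)) -
    (c.N * a * b) ^ 2 * (1 / (c.mh * c.mr)) : ℝ) =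
      c.N * (1 - a ^ 2 * b ^ 2 * (1 / (c.mh * c.mr))) := by ring
  rw [this]
  exact mul_pos hN (by linarith)

theorem κr_pos : 0 < c.κr := div_pos (pow_pos c.meanSr_pos 2) c.variance_Sr_pos

theorem ωr_pos : 0 < c.ωr := div_pos c.variance_Sr_pos c.meanSr_pos

theorem β_pos : 0 < c.β := by
  have := Real.rpow_pos_of_pos c.d₀_pos (-c.α)
  have := c.Cr_pos
  have := c.Cd_pos
  exact Real.sqrt_pos.2 (by positivity)

theorem μς_succ (q : ℕ) : c.μς (q + 1) = c.ωr * (q + c.κr) * c.μς q := by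
  have h := c.κr_pos
  have hq : (q : ℝ) + c.κr ≠ 0 := by positivity
  unfold μς
  push_cast
  rw [show (q : ℝ) + 1 + c.κr = q + c.κr + 1 by ring, Real.Gamma_add_one hq]
  ring

theorem μς_zero : c.μς 0 = 1 := by
  have := (Real.Gamma_pos_of_pos c.κr_pos).ne'
  simp [μς, this]

/-- After the moments are reduced by `Γ(s + 1) = s Γ(s)`, the variance is a polynomial in positive
quantities whose only doubtful coefficient is `1 - (√π / 2)²`, positive because `π < 4`. -/
theorem χ_pos : 0 < c.χ₁ ∧ 0 < c.χ₂ - c.χ₁ ^ 2 := by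
  have hκ := c.κr_pos
  have hω := c.ωr_pos
  have hβ := c.β_pos
  have g1 : μg 1 = √Real.pi / 2 := by
    rw [← Gamma_three_half]; unfold μg; norm_num
  have g2 : μg 2 = 1 := by unfold μg; norm_num
  have g3 : μg 3 = 3 / 2 * (√Real.pi / 2) := by
    rw [← Gamma_five_half]; unfold μg; norm_num
  have g4 : μg 4 = 2 := by
    unfold μg
    rw [show (1 + (4 : ℕ) / 2 : ℝ) = (2 : ℕ) + 1 by norm_num, Real.Gamma_nat_eq_factorial]
    norm_num
  have s1 : c.μς 1 = c.ωr * c.κr := by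
    rw [c.μς_succ 0, c.μς_zero]; push_cast; ring
  have s2 : c.μς 2 = c.ωr ^ 2 * (c.κr * (c.κr + 1)) := by
    rw [c.μς_succ 1, s1]; push_cast; ring
  have s3 : c.μς 3 = c.ωr ^ 3 * (c.κr * (c.κr + 1) * (c.κr + 2)) := by
    rw [c.μς_succ 2, s2]; push_cast; ring
  have s4 : c.μς 4 = c.ωr ^ 4 * (c.κr * (c.κr + 1) * (c.κr + 2) * (c.κr + 3)) := by
    rw [c.μς_succ 3, s3]; push_cast; ring
  unfold χ₁ χ₂
  rw [g1, g2, g3, g4, s1, s2, s3, s4]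
  have hg : 0 < √Real.pi / 2 := by have := Real.pi_pos; positivity
  have hg1 : (√Real.pi / 2) ^ 2 < 1 := by
    rw [div_pow, Real.sq_sqrt Real.pi_pos.le]
    linarith [Real.pi_lt_four]
  set g := √Real.pi / 2
  set k := c.κr
  set w := c.ωr
  set b := c.β
  refine ⟨by positivity, ?_⟩
  have : 2 + 4 * b * (3 / 2 * g) * (w * k) + 6 * b ^ 2 * 1 * (w ^ 2 * (k * (k + 1))) +
      4 * b ^ 3 * g * (w ^ 3 * (k * (k + 1) * (k + 2))) +
      b ^ 4 * (w ^ 4 * (k * (k + 1) * (k + 2) * (k + 3))) -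
      (1 + 2 * b * g * (w * k) + b ^ 2 * (w ^ 2 * (k * (k + 1)))) ^ 2 =
      1 + 2 * (b * w) * k * g + 4 * (b * w) ^ 2 * k * (k * (1 - g ^ 2) + 1) +
      8 * (b * w) ^ 3 * g * k * (k + 1) +
      (b * w) ^ 4 * (k * (k + 1) * (4 * k + 6)) := by ring
  rw [this]
  have : 0 < 1 - g ^ 2 := by linarith
  positivity

theorem χbar_pos : 0 < c.χbar := div_pos c.χ_pos.2 c.χ_pos.1

theorem e₁_pos : 0 < c.e₁ := by
  have := Real.rpow_pos_of_pos c.d₀_pos (-c.α)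
  have := c.Cr_pos
  have := c.Cd_pos
  unfold e₁
  positivity

theorem γt_pos : 0 < c.γt := div_pos c.P_pos c.noise_pos

theorem κhat_pos : 0 < c.κhat := lt_of_lt_of_le one_pos (le_max_left _ _)

end Params

/-! ### The function `exp (-x)` on `[0, ∞]` -/

/-- The function `x ↦ exp (-x)` on `[0, ∞]`. -/
def expNeg (x : ℝ≥0∞) : ℝ≥0∞ := EReal.exp (-(x : EReal))

@[simp] theorem expNeg_zero : expNeg 0 = 1 := by simp [expNeg]

@[simp] theorem expNeg_top : expNeg ∞ = 0 := by simp [expNeg]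

theorem expNeg_ofReal {x : ℝ} (hx : 0 ≤ x) :
    expNeg (ENNReal.ofReal x) = ENNReal.ofReal (Real.exp (-x)) := by
  unfold expNeg
  rw [EReal.coe_ennreal_ofReal, max_eq_left hx, ← EReal.coe_neg, EReal.exp_coe]

theorem expNeg_eq_of_ne_top {x : ℝ≥0∞} (hx : x ≠ ∞) :
    expNeg x = ENNReal.ofReal (Real.exp (-x.toReal)) := by
  rw [← expNeg_ofReal ENNReal.toReal_nonneg, ENNReal.ofReal_toReal hx]

theorem expNeg_ofReal_neg_log {v : ℝ} (h0 : 0 < v) (h1 : v ≤ 1) :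
    expNeg (ENNReal.ofReal (-Real.log v)) = ENNReal.ofReal v := by
  rw [expNeg_ofReal (by linarith [Real.log_nonpos h0.le h1]), neg_neg, Real.exp_log h0]

theorem expNeg_add (x y : ℝ≥0∞) : expNeg (x + y) = expNeg x * expNeg y := by
  unfold expNeg
  rw [← EReal.exp_add, EReal.coe_ennreal_add,
    EReal.neg_add (.inl (EReal.coe_ennreal_ne_bot _)) (.inr (EReal.coe_ennreal_ne_bot _)),
    sub_eq_add_neg]

theorem expNeg_sum {ι : Type*} (s : Finset ι) (f : ι → ℝ≥0∞) :
    expNeg (∑ i ∈ s, f i) = ∏ i ∈ s, expNeg (f i) := by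
  classical
  induction s using Finset.induction_on with
  | empty => simp
  | insert a s ha ih => rw [Finset.sum_insert ha, Finset.prod_insert ha, expNeg_add, ih]

theorem antitone_expNeg : Antitone expNeg := fun x y h => by
  unfold expNeg
  rw [EReal.exp_le_exp_iff, EReal.neg_le_neg_iff]
  exact_mod_cast h

theorem expNeg_le_one (x : ℝ≥0∞) : expNeg x ≤ 1 := by
  rw [← expNeg_zero]
  exact antitone_expNeg zero_le

/-- Continuity up to `∞` lets limits of partial sums pass through the exponential even when the sum
diverges. -/
theorem continuous_expNeg : Continuous expNeg :=
  ENNReal.continuous_exp.comp (continuous_neg.comp continuous_coe_ennreal_ereal)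

@[fun_prop]
theorem measurable_expNeg : Measurable expNeg := continuous_expNeg.measurable

theorem expNeg_mul_natCast (x : ℝ≥0∞) (n : ℕ) : expNeg (x * n) = expNeg x ^ n := by
  rw [mul_comm, ← nsmul_eq_mul]
  have := expNeg_sum (Finset.range n) (fun _ => x)
  simpa using this

/-! ### Poisson counts -/

theorem lintegral_poissonMeasure (r : ℝ≥0) (g : ℕ → ℝ≥0∞) :
    ∫⁻ m, g m ∂poissonMeasure r =
      ∑' m, g m * ENNReal.ofReal (Real.exp (-r) * r ^ m / m.factorial) := by
  rw [lintegral_countable']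
  simp_rw [poissonMeasure_singleton]

theorem lintegral_poissonMeasure_pow (r : ℝ≥0) {v : ℝ} (hv : 0 ≤ v) :
    ∫⁻ m, ENNReal.ofReal v ^ m ∂poissonMeasure r =
      ENNReal.ofReal (Real.exp (-(r * (1 - v)))) := by
  rw [lintegral_poissonMeasure]
  have h : HasSum (fun m : ℕ => v ^ m * (Real.exp (-r) * r ^ m / m.factorial))
      (Real.exp (-(r * (1 - v)))) := by
    have h1 := (NormedSpace.expSeries_div_hasSum_exp (r * v : ℝ)).mul_left (Real.exp (-r))
    rw [← Real.exp_eq_exp_ℝ, ← Real.exp_add] at h1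
    convert! h1 using 1
    · funext m
      rw [mul_pow]
      ring
    · congr 1
      ring
  rw [← h.tsum_eq, ENNReal.ofReal_tsum_of_nonneg (fun m => by positivity) h.summable]
  congr 1 with m
  rw [ENNReal.ofReal_mul (by positivity), ENNReal.ofReal_pow hv]

theorem HasLaw_lintegral_count {Ω : Type*} [MeasurableSpace Ω] {Pr : Measure Ω} {X : Ω → ℕ∞}
    {r : ℝ≥0} (h : HasLaw X ((poissonMeasure r).map (Nat.cast : ℕ → ℕ∞)) Pr) (g : ℕ∞ → ℝ≥0∞) :
    ∫⁻ ω, g (X ω) ∂Pr = ∫⁻ m : ℕ, g m ∂poissonMeasure r := by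
  rw [h.lintegral_comp (Measurable.of_discrete (f := g)).aemeasurable,
    lintegral_map Measurable.of_discrete Measurable.of_discrete]

/-- The image of a Poisson process under a measurable map. -/
theorem IsPoissonProcess.map {Ω E F : Type*} [MeasurableSpace Ω] [MeasurableSpace E]
    [MeasurableSpace F] {Λ : Measure E} {Φ : ℕ → Ω → E} {Pr : Measure Ω}
    (h : IsPoissonProcess Λ Φ Pr) {g : E → F} (hg : Measurable g) :
    IsPoissonProcess (Λ.map g) (fun k ω => g (Φ k ω)) Pr where
  measurable k := hg.comp (h.measurable k)
  hasLaw_count B hB hfin := by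
    rw [Measure.map_apply hg hB] at hfin ⊢
    exact h.hasLaw_count _ (hg hB) hfin
  iIndepFun_count n B hB hfin hdisj := by
    refine h.iIndepFun_count n (fun i => g ⁻¹' B i) (fun i => hg (hB i)) (fun i => ?_)
      (fun i j hij => (hdisj i j hij).preimage g)
    rw [← Measure.map_apply hg (hB i)]
    exact hfin i

theorem toENNReal_count {Ω E : Type*} (Φ : ℕ → Ω → E) (B : Set E) (ω : Ω) [DecidablePred (· ∈ B)] :
    (count Φ B ω : ℝ≥0∞) = ∑' k, if Φ k ω ∈ B then 1 else 0 := by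
  unfold count
  rw [← ENNReal.tsum_set_one, tsum_subtype {k | Φ k ω ∈ B} (fun _ => (1 : ℝ≥0∞))]
  congr 1 with k
  simp [indicator]

theorem measurable_count {Ω E : Type*} [MeasurableSpace Ω] [MeasurableSpace E] {Φ : ℕ → Ω → E}
    (hΦ : ∀ k, Measurable (Φ k)) {B : Set E} (hB : MeasurableSet B) : Measurable (count Φ B) := by
  classical
  have h : Measurable fun ω => (count Φ B ω : ℝ≥0∞) := by
    simp_rw [toENNReal_count]
    exact Measurable.tsum fun k => Measurable.ite (hΦ k hB) measurable_const measurable_const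
  refine measurable_to_countable' fun m => ?_
  have : count Φ B ⁻¹' {m} = (fun ω => (count Φ B ω : ℝ≥0∞)) ⁻¹' {(m : ℝ≥0∞)} := by
    ext ω
    simp
  rw [this]
  exact h (measurableSet_singleton _)

/-! ### Dyadic grids of the half-line -/

/-- Index of the cell of the dyadic grid of mesh `2⁻ⁿ` that contains `u`. -/
def cell (n : ℕ) (u : ℝ) : ℕ := ⌊2 ^ n * u⌋₊

theorem monotone_cell (n : ℕ) : Monotone (cell n) := fun u v h => by
  unfold cell
  gcongr

@[fun_prop]
theorem measurable_cell (n : ℕ) : Measurable (cell n) :=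
  Nat.measurable_floor.comp (measurable_const_mul _)

/-- Integer division by two sends a cell to its parent; all monotonicity in `n` below rests on this.
-/
theorem cell_succ_div_two (n : ℕ) (u : ℝ) : cell (n + 1) u / 2 = cell n u := by
  unfold cell
  rw [← Nat.floor_div_ofNat]
  congr 1
  rw [pow_succ]
  ring

theorem tendsto_two_pow : Tendsto (fun n : ℕ => (2 : ℝ) ^ n) atTop atTop :=
  tendsto_pow_atTop_atTop_of_one_lt (by norm_num)

theorem tendsto_cell_div {u : ℝ} (hu : 0 ≤ u) :
    Tendsto (fun n : ℕ => (cell n u : ℝ) / 2 ^ n) atTop (𝓝 u) := by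
  have := (tendsto_nat_floor_mul_div_atTop hu).comp tendsto_two_pow
  simpa [Function.comp_def, cell, mul_comm] using this

theorem tendsto_cell_add_one_div {u : ℝ} (hu : 0 ≤ u) :
    Tendsto (fun n : ℕ => ((cell n u : ℝ) + 1) / 2 ^ n) atTop (𝓝 u) := by
  have := (tendsto_cell_div hu).add (tendsto_inv_atTop_zero.comp tendsto_two_pow)
  simpa [Function.comp_def, add_div] using this

/-- The first `4ⁿ` cells of mesh `2⁻ⁿ` cover `[0, 2ⁿ)`: the window grows while the mesh shrinks. -/
theorem eventually_cell_lt {u : ℝ} (hu : 0 ≤ u) : ∀ᶠ n in atTop, cell n u < 4 ^ n := by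
  filter_upwards [(tendsto_cell_div hu).eventually_lt_const (lt_add_one u),
    tendsto_two_pow.eventually_gt_atTop (u + 1)] with n h1 h2
  have h3 : (cell n u : ℝ) / 2 ^ n < 2 ^ n := h1.trans h2
  rw [div_lt_iff₀ (by positivity), ← mul_pow] at h3
  norm_num at h3
  exact_mod_cast h3

theorem eventually_cell_lt_cell {u x : ℝ} (hu : 0 ≤ u) (hux : u < x) :
    ∀ᶠ n in atTop, cell n u < cell n x := by
  filter_upwards [(tendsto_cell_div hu).eventually_lt (tendsto_cell_div (hu.trans hux.le)) hux]
    with n h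
  rw [div_lt_div_iff_of_pos_right (by positivity)] at h
  exact_mod_cast h

/-- The intersection with `Ici 0` matters for `i = 0`: the natural floor sends every negative number
to cell `0`. -/
theorem cell_preimage_inter (n i : ℕ) :
    cell n ⁻¹' {i} ∩ Ici 0 = Ico ((i : ℝ) / 2 ^ n) (((i : ℝ) + 1) / 2 ^ n) := by
  have h2 : (0 : ℝ) < 2 ^ n := by positivity
  ext u
  simp only [mem_inter_iff, mem_preimage, mem_singleton_iff, mem_Ici, mem_Ico]
  rw [div_le_iff₀ h2, lt_div_iff₀ h2, mul_comm u]
  unfold cell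
  constructor
  · rintro ⟨h, h0⟩
    exact (Nat.floor_eq_iff (by positivity)).1 h
  · intro h
    have h0 : 0 ≤ 2 ^ n * u := (Nat.cast_nonneg i).trans h.1
    exact ⟨(Nat.floor_eq_iff h0).2 h, nonneg_of_mul_nonneg_right h0 h2⟩

theorem volume_cell (n i : ℕ) :
    (volume.restrict (Ici (0 : ℝ))) (cell n ⁻¹' {i}) = ENNReal.ofReal (1 / 2 ^ n) := by
  rw [Measure.restrict_apply (measurable_cell n (measurableSet_singleton i)), cell_preimage_inter,
    Real.volume_Ico]
  congr 1
  ring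

theorem lintegral_comp_cell (n : ℕ) (f : ℕ → ℝ≥0∞) :
    ∫⁻ u in Ici (0 : ℝ), f (cell n u) = ∑' j, f j * ENNReal.ofReal (1 / 2 ^ n) := by
  rw [← lintegral_map (f := f) (g := cell n) Measurable.of_discrete (measurable_cell n),
    lintegral_countable']
  congr 1 with j
  rw [Measure.map_apply (measurable_cell n) (measurableSet_singleton j), volume_cell]

/-- Discretisation on the dyadic grid of `(u, x) ↦ 𝟙 {u < x} ψ (u / x)`. -/
def gridFun (ψ : ℝ → ℝ≥0∞) (n : ℕ) (i j : ℕ) : ℝ≥0∞ :=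
  if i < j ∧ j < 4 ^ n then ψ (i / (j + 1)) else 0

/-- The ratio `i / (j + 1)`, left end of the cell of `u` over right end of the cell of `x`,
underestimates `u / x` and increases under refinement. This choice of ends is what allows monotone
convergence later, for sums and for integrals. -/
theorem monotone_gridFun {ψ : ℝ → ℝ≥0∞} (hψ : MonotoneOn ψ (Ici 0)) (u x : ℝ) :
    Monotone fun n => gridFun ψ n (cell n u) (cell n x) := by
  refine monotone_nat_of_le_succ fun n => ?_
  rw [← cell_succ_div_two n u, ← cell_succ_div_two n x]
  generalize cell (n + 1) u = a
  generalize cell (n + 1) x = b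
  unfold gridFun
  split_ifs with h1 h2 h2
  · refine hψ (by rw [mem_Ici]; positivity) (by rw [mem_Ici]; positivity) ?_
    rw [div_le_div_iff₀ (by positivity) (by positivity)]
    have h : a / 2 * (b + 1) ≤ a * (b / 2 + 1) :=
      calc a / 2 * (b + 1) ≤ a / 2 * (2 * (b / 2 + 1)) := by gcongr; omega
        _ = (a / 2 * 2) * (b / 2 + 1) := by ring
        _ ≤ a * (b / 2 + 1) := by gcongr; omega
    exact_mod_cast h
  · exfalso
    apply h2
    have : 4 ^ (n + 1) = 4 * 4 ^ n := by ring
    omega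
  · exact zero_le
  · exact le_rfl

theorem tendsto_gridFun {ψ : ℝ → ℝ≥0∞} (hψ : Continuous ψ) {u x : ℝ} (hu : 0 ≤ u) (hx : 0 ≤ x) :
    Tendsto (fun n => gridFun ψ n (cell n u) (cell n x)) atTop
      (𝓝 (if u < x then ψ (u / x) else 0)) := by
  split_ifs with h
  · have h1 : Tendsto (fun n => ψ ((cell n u : ℝ) / ((cell n x : ℝ) + 1))) atTop
        (𝓝 (ψ (u / x))) := by
      refine (hψ.tendsto _).comp ?_
      have := (tendsto_cell_div hu).div (tendsto_cell_add_one_div hx) (hu.trans_lt h).ne'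
      refine this.congr fun n => ?_
      have : (0 : ℝ) < 2 ^ n := by positivity
      simp only [Pi.div_apply]
      field_simp
    refine h1.congr' ?_
    filter_upwards [eventually_cell_lt_cell hu h, eventually_cell_lt hx] with n h2 h3
    rw [gridFun, if_pos ⟨h2, h3⟩]
  · refine tendsto_const_nhds.congr fun n => ?_
    rw [gridFun, if_neg]
    rintro ⟨h1, -⟩
    exact absurd (monotone_cell n (not_lt.1 h)) (not_le.2 h1)

/-! ### Laplace functional seen from the nearest point of a Poisson process -/

section Nearest

variable {Ω : Type*} {U : ℕ → Ω → ℝ}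

/-- On the dyadic grid of mesh `2⁻ⁿ`, the point `k` lies in a strictly smaller cell than all the
other points. -/
def Isolated (U : ℕ → Ω → ℝ) (n : ℕ) (ω : Ω) (k : ℕ) : Prop :=
  cell n (U k ω) < 4 ^ n ∧ ∀ k', k' ≠ k → cell n (U k ω) < cell n (U k' ω)

theorem Isolated.succ {n : ℕ} {ω : Ω} {k : ℕ} (h : Isolated U n ω k) :
    Isolated U (n + 1) ω k := by
  refine ⟨?_, fun k' hk' => ?_⟩
  · have := h.1
    rw [← cell_succ_div_two] at this
    have : 4 ^ (n + 1) = 4 * 4 ^ n := by ring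
    omega
  · have := h.2 k' hk'
    rw [← cell_succ_div_two, ← cell_succ_div_two n (U k' ω)] at this
    omega

theorem Isolated.mono {n m : ℕ} (hnm : n ≤ m) {ω : Ω} {k : ℕ} (h : Isolated U n ω k) :
    Isolated U m ω k := by
  induction m, hnm using Nat.le_induction with
  | base => exact h
  | succ m _ ih => exact ih.succ

theorem Isolated.lt {n : ℕ} {ω : Ω} {k : ℕ} (h : Isolated U n ω k) {k' : ℕ} (hk' : k' ≠ k) :
    U k ω < U k' ω := by
  by_contra hc
  exact absurd (monotone_cell n (not_lt.1 hc)) (not_le.2 (h.2 k' hk'))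

/-- Contribution of the number `m` of points of the cell `i` when the nearest point is in cell `j`. -/
def cellFactor (φ : ℝ → ℝ≥0∞) (j i : ℕ) (m : ℕ∞) : ℝ≥0∞ :=
  if i < j then (if m = 0 then 1 else 0)
  else if i = j then (if m = 1 then 1 else 0)
  else expNeg (φ (j / (i + 1)) * m)

/-- Number of points in a cell of the dyadic grid. -/
def cellCount (U : ℕ → Ω → ℝ) (n i : ℕ) (ω : Ω) : ℕ∞ := count U (cell n ⁻¹' {i}) ω

/-- Discretisation of the functional `w (U *) exp (-∑ φ (U * / U k))`, where `U *` is the nearest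
point. -/
def gridSum (U : ℕ → Ω → ℝ) (φ w : ℝ → ℝ≥0∞) (n : ℕ) (ω : Ω) : ℝ≥0∞ :=
  ∑ j ∈ Finset.range (4 ^ n),
    w (j / 2 ^ n) * ∏ i ∈ Finset.range (4 ^ n), cellFactor φ j i (cellCount U n i ω)

/-- A nonzero product for `j` forces exactly one point in cell `j` and none in the cells before it.
-/
theorem exists_isolated_of_gridSum_ne_zero {φ w : ℝ → ℝ≥0∞} {n : ℕ} {ω : Ω}
    (h : gridSum U φ w n ω ≠ 0) : ∃ k, Isolated U n ω k := by
  obtain ⟨j, hj, hne⟩ := Finset.exists_ne_zero_of_sum_ne_zero h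
  rw [Finset.mem_range] at hj
  have hfac := Finset.prod_ne_zero_iff.1 (right_ne_zero_of_mul hne)
  have h1 : cellCount U n j ω = 1 := by
    by_contra hc
    exact hfac j (Finset.mem_range.2 hj) (by simp [cellFactor, hc])
  obtain ⟨k, hk⟩ := encard_eq_one.1 h1
  have hkj : cell n (U k ω) = j := by
    have : k ∈ {k | U k ω ∈ cell n ⁻¹' {j}} := by rw [hk]; rfl
    simpa using this
  refine ⟨k, hkj ▸ hj, fun k' hk' => ?_⟩
  rw [hkj]
  rcases lt_trichotomy (cell n (U k' ω)) j with hlt | heq | hgt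
  · exfalso
    refine hfac (cell n (U k' ω)) (Finset.mem_range.2 (hlt.trans hj)) ?_
    have : cellCount U n (cell n (U k' ω)) ω ≠ 0 := by
      unfold cellCount count
      rw [encard_ne_zero]
      exact ⟨k', rfl⟩
    simp [cellFactor, hlt, this]
  · exfalso
    apply hk'
    have : k' ∈ {k | U k ω ∈ cell n ⁻¹' {j}} := heq
    rw [hk] at this
    exact this
  · exact hgt

theorem Isolated.cellCount_eq {n : ℕ} {ω : Ω} {k : ℕ} (h : Isolated U n ω k) :
    cellCount U n (cell n (U k ω)) ω = 1 := by
  unfold cellCount count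
  rw [encard_eq_one]
  refine ⟨k, ?_⟩
  ext k'
  simp only [mem_preimage, mem_singleton_iff, mem_ofPred_eq]
  constructor
  · intro h'
    by_contra hne
    exact (h.2 k' hne).ne' h'
  · rintro rfl
    rfl

theorem Isolated.cellCount_eq_zero {n : ℕ} {ω : Ω} {k : ℕ} (h : Isolated U n ω k) {i : ℕ}
    (hi : i < cell n (U k ω)) : cellCount U n i ω = 0 := by
  unfold cellCount count
  rw [encard_eq_zero, eq_empty_iff_forall_notMem]
  intro k' hk'
  have hk' : cell n (U k' ω) = i := hk'
  rcases eq_or_ne k' k with rfl | hne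
  · omega
  · have := h.2 k' hne
    omega

theorem Isolated.gridSum_eq {n : ℕ} {ω : Ω} {k : ℕ} (h : Isolated U n ω k) (φ w : ℝ → ℝ≥0∞) :
    gridSum U φ w n ω = w (cell n (U k ω) / 2 ^ n) *
      expNeg (∑' k', gridFun φ n (cell n (U k ω)) (cell n (U k' ω))) := by
  classical
  unfold gridSum
  -- Any other `j` has a zero factor: a smaller `j` asks for a point in an empty cell, a larger one
  -- asks that the cell of `k` be empty.
  rw [Finset.sum_eq_single_of_mem (cell n (U k ω)) (Finset.mem_range.2 h.1)]
  · congr 1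
    have h1 : ∀ i ∈ Finset.range (4 ^ n), cellFactor φ (cell n (U k ω)) i (cellCount U n i ω) =
        expNeg ((if cell n (U k ω) < i then φ (cell n (U k ω) / (i + 1)) else 0) *
          cellCount U n i ω) := by
      intro i _
      unfold cellFactor
      rcases lt_trichotomy i (cell n (U k ω)) with hlt | heq | hgt
      · simp [hlt, hlt.not_gt, h.cellCount_eq_zero hlt]
      · simp [heq, h.cellCount_eq]
      · simp [hgt, hgt.not_gt, hgt.ne']
    rw [Finset.prod_congr rfl h1, ← expNeg_sum]
    congr 1
    unfold cellCount
    simp_rw [toENNReal_count, ← ENNReal.tsum_mul_left]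
    rw [← Summable.tsum_finsetSum (fun _ _ => ENNReal.summable)]
    congr 1 with k'
    simp only [mem_preimage, mem_singleton_iff, mul_ite, mul_one, mul_zero, Finset.sum_ite_eq,
      Finset.mem_range, gridFun]
    split_ifs <;> simp_all
  · intro j _ hne
    apply mul_eq_zero_of_right
    rcases lt_or_gt_of_ne hne with hlt | hgt
    · refine Finset.prod_eq_zero (Finset.mem_range.2 (hlt.trans h.1)) ?_
      simp [cellFactor, h.cellCount_eq_zero hlt]
    · refine Finset.prod_eq_zero (Finset.mem_range.2 h.1) ?_
      simp [cellFactor, h.cellCount_eq, hgt]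

theorem gridSum_le_one {φ w : ℝ → ℝ≥0∞} (hw : ∀ t, w t ≤ 1) (n : ℕ) (ω : Ω) :
    gridSum U φ w n ω ≤ 1 := by
  by_cases h : gridSum U φ w n ω = 0
  · rw [h]
    exact zero_le
  · obtain ⟨k, hk⟩ := exists_isolated_of_gridSum_ne_zero h
    rw [hk.gridSum_eq]
    exact mul_le_one' (hw _) (expNeg_le_one _)

/-- Pointwise convergence of the discretised functional. -/
theorem Isolated.tendsto_gridSum {m : ℕ} {ω : Ω} {k : ℕ} (h : Isolated U m ω k)
    (hU : ∀ k, 0 ≤ U k ω) {φ w : ℝ → ℝ≥0∞} (hφ : Continuous φ) (hφm : MonotoneOn φ (Ici 0))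
    (hw : Continuous w) (hw1 : ∀ t, w t ≤ 1) :
    Tendsto (fun n => gridSum U φ w n ω) atTop
      (𝓝 (w (U k ω) * expNeg (∑' k', if k' = k then 0 else φ (U k ω / U k' ω)))) := by
  have hwlim : Tendsto (fun n => w ((cell n (U k ω) : ℝ) / 2 ^ n)) atTop (𝓝 (w (U k ω))) :=
    (hw.tendsto _).comp (tendsto_cell_div (hU k))
  have hsum : Tendsto (fun n => ∑' k', gridFun φ n (cell n (U k ω)) (cell n (U k' ω))) atTop
      (𝓝 (∑' k', if k' = k then 0 else φ (U k ω / U k' ω))) := by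
    simp_rw [← lintegral_count]
    -- Monotone convergence for the counting measure on the indices of the points.
    refine lintegral_tendsto_of_tendsto_of_monotone
      (fun n => Measurable.of_discrete.aemeasurable)
      (ae_of_all _ fun k' => monotone_gridFun hφm _ _) (ae_of_all _ fun k' => ?_)
    have := tendsto_gridFun hφ (hU k) (hU k')
    rcases eq_or_ne k' k with rfl | hne
    · simpa using this
    · simpa [hne, h.lt hne] using this
  have hexp := (continuous_expNeg.tendsto _).comp hsum
  refine (ENNReal.Tendsto.mul hwlim (.inr ?_) hexp (.inr ?_)).congr' ?_
  · exact ((expNeg_le_one _).trans_lt ENNReal.one_lt_top).ne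
  · exact ((hw1 _).trans_lt ENNReal.one_lt_top).ne
  · filter_upwards [eventually_ge_atTop m] with n hn
    exact ((h.mono hn).gridSum_eq φ w).symm

theorem measurable_gridSum [MeasurableSpace Ω] (hU : ∀ k, Measurable (U k)) (φ w : ℝ → ℝ≥0∞)
    (n : ℕ) : Measurable (gridSum U φ w n) := by
  unfold gridSum
  refine Finset.measurable_sum _ fun j _ => Measurable.const_mul ?_ _
  refine Finset.measurable_prod _ fun i _ => ?_
  exact (Measurable.of_discrete (f := cellFactor φ j i)).comp
    (measurable_count hU (measurable_cell n (measurableSet_singleton i)))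

variable [MeasurableSpace Ω] {Pr : Measure Ω}

/-- The count is Poisson of mean `δ = 2⁻ⁿ`. The three cases are its mass at `0`, its mass at `1`,
and its generating function at `V`, as `φ = -log V` turns `expNeg (φ * m)` into `V ^ m`. -/
theorem lintegral_cellFactor (hU : IsPoissonProcess (volume.restrict (Ici (0 : ℝ))) U Pr)
    {V : ℝ → ℝ} (hV0 : ∀ t, 0 < V t) (hV1 : ∀ t, V t ≤ 1) (n j i : ℕ) :
    ∫⁻ ω, cellFactor (fun t => ENNReal.ofReal (-Real.log (V t))) j i (cellCount U n i ω) ∂Pr =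
      ENNReal.ofReal (if i < j then Real.exp (-(1 / 2 ^ n))
        else if i = j then 1 / 2 ^ n * Real.exp (-(1 / 2 ^ n))
        else Real.exp (-(1 / 2 ^ n * (1 - V (j / (i + 1)))))) := by
  have hlaw := hU.hasLaw_count (cell n ⁻¹' {i}) (measurable_cell n (measurableSet_singleton i))
    (by rw [volume_cell]; exact ENNReal.ofReal_lt_top)
  rw [volume_cell, show (ENNReal.ofReal (1 / 2 ^ n)).toNNReal = (1 / 2 ^ n : ℝ).toNNReal from rfl] at hlaw
  have hr : ((1 / 2 ^ n : ℝ).toNNReal : ℝ) = 1 / 2 ^ n := Real.coe_toNNReal _ (by positivity)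
  unfold cellCount
  rw [HasLaw_lintegral_count hlaw]
  unfold cellFactor
  split_ifs with h1 h2
  · rw [lintegral_poissonMeasure, tsum_eq_single 0 (fun m hm => by simp [hm]), hr]
    simp
  · rw [lintegral_poissonMeasure, tsum_eq_single 1 (fun m hm => by simp [hm]), hr]
    simp [mul_comm]
  · have h3 := lintegral_poissonMeasure_pow (1 / 2 ^ n : ℝ).toNNReal (hV0 (j / (i + 1))).le
    rw [hr] at h3
    rw [← h3]
    refine lintegral_congr fun m => ?_
    rw [ENat.toENNReal_coe, expNeg_mul_natCast, expNeg_ofReal_neg_log (hV0 _) (hV1 _)]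

/-- The lone factor `δ` will become `du`, the `j + 1` factors `exp (-δ)` become `exp (-u)`, and the
cells beyond `j` form a Riemann sum in the exponent. -/
theorem prod_gridWeights {ψ : ℕ → ℝ} (hψ : ∀ i, 0 ≤ ψ i) {δ : ℝ} (hδ : 0 ≤ δ) {j K : ℕ}
    (hj : j < K) :
    ∏ i ∈ Finset.range K, ENNReal.ofReal (if i < j then Real.exp (-δ)
        else if i = j then δ * Real.exp (-δ) else Real.exp (-(δ * ψ i))) =
      ENNReal.ofReal δ * ENNReal.ofReal (Real.exp (-((j + 1) * δ))) *
        expNeg (∑ i ∈ Finset.range K, if j < i then ENNReal.ofReal (ψ i) * ENNReal.ofReal δ else 0) := by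
  have h1 : ∀ i, ENNReal.ofReal (if i < j then Real.exp (-δ)
        else if i = j then δ * Real.exp (-δ) else Real.exp (-(δ * ψ i))) =
      (if i = j then ENNReal.ofReal δ else 1) * ((if i < j + 1 then ENNReal.ofReal (Real.exp (-δ)) else 1) *
        expNeg (if j < i then ENNReal.ofReal (ψ i) * ENNReal.ofReal δ else 0)) := by
    intro i
    rcases lt_trichotomy i j with h | h | h
    · simp [h, h.ne, h.not_gt, h.trans (Nat.lt_succ_self j)]
    · simp [h, ENNReal.ofReal_mul hδ]
    · have h' : ¬ i < j + 1 := by omega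
      rw [if_neg h.not_gt, if_neg h.ne', if_neg h.ne', if_neg h', if_pos h, ← ENNReal.ofReal_mul (hψ i),
        expNeg_ofReal (mul_nonneg (hψ i) hδ), one_mul, one_mul, mul_comm δ]
  simp_rw [h1]
  rw [Finset.prod_mul_distrib, Finset.prod_mul_distrib, ← expNeg_sum, Finset.prod_ite_eq',
    if_pos (Finset.mem_range.2 hj), ← mul_assoc]
  congr 2
  rw [← Finset.prod_filter]
  have : (Finset.range K).filter (fun i => i < j + 1) = Finset.range (j + 1) := by
    ext i
    simp only [Finset.mem_filter, Finset.mem_range]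
    omega
  rw [this, Finset.prod_const, Finset.card_range, ← ENNReal.ofReal_pow (Real.exp_pos _).le,
    ← Real.exp_nat_mul]
  push_cast
  ring_nf

/-- Counts in distinct cells are independent, so the mean of each product factorises; the weights
`2⁻ⁿ` are then read as cell lengths, turning the sums into integrals of step functions. -/
theorem lintegral_gridSum (hU : IsPoissonProcess (volume.restrict (Ici (0 : ℝ))) U Pr)
    {V : ℝ → ℝ} (hV0 : ∀ t, 0 < V t) (hV1 : ∀ t, V t ≤ 1) (w : ℝ → ℝ≥0∞) (n : ℕ) :
    ∫⁻ ω, gridSum U (fun t => ENNReal.ofReal (-Real.log (V t))) w n ω ∂Pr =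
      ∫⁻ u in Ici (0 : ℝ), if cell n u < 4 ^ n then
        w (cell n u / 2 ^ n) * ENNReal.ofReal (Real.exp (-((cell n u + 1) / 2 ^ n))) *
          expNeg (∫⁻ x in Ici (0 : ℝ),
            gridFun (fun t => ENNReal.ofReal (1 - V t)) n (cell n u) (cell n x)) else 0 := by
  have hmeas : ∀ j i, Measurable fun ω =>
      cellFactor (fun t => ENNReal.ofReal (-Real.log (V t))) j i (cellCount U n i ω) := fun j i =>
    (Measurable.of_discrete (f := cellFactor _ j i)).comp
      (measurable_count hU.measurable (measurable_cell n (measurableSet_singleton i)))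
  have hind := hU.iIndepFun_count (4 ^ n) (fun i => cell n ⁻¹' {(i : ℕ)})
    (fun i => measurable_cell n (measurableSet_singleton _))
    (fun i => by rw [volume_cell]; exact ENNReal.ofReal_lt_top)
    (fun i j hij => Disjoint.preimage _ (by
      rw [disjoint_singleton]
      exact fun h => hij (Fin.ext h)))
  unfold gridSum
  rw [lintegral_finsetSum _ (fun j _ => (Finset.measurable_prod _ fun i _ => hmeas j i).const_mul _)]
  have hprod : ∀ j : ℕ, j < 4 ^ n → ∫⁻ ω, w (j / 2 ^ n) * ∏ i ∈ Finset.range (4 ^ n),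
      cellFactor (fun t => ENNReal.ofReal (-Real.log (V t))) j i (cellCount U n i ω) ∂Pr =
      (w (j / 2 ^ n) * ENNReal.ofReal (Real.exp (-((j + 1) / 2 ^ n))) *
        expNeg (∫⁻ x in Ici (0 : ℝ),
          gridFun (fun t => ENNReal.ofReal (1 - V t)) n j (cell n x))) * ENNReal.ofReal (1 / 2 ^ n) := by
    intro j hj
    rw [lintegral_const_mul _ (Finset.measurable_prod _ fun i _ => hmeas j i)]
    have h1 : ∫⁻ ω, ∏ i ∈ Finset.range (4 ^ n),
        cellFactor (fun t => ENNReal.ofReal (-Real.log (V t))) j i (cellCount U n i ω) ∂Pr =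
        ∏ i ∈ Finset.range (4 ^ n), ∫⁻ ω,
        cellFactor (fun t => ENNReal.ofReal (-Real.log (V t))) j i (cellCount U n i ω) ∂Pr := by
      simp_rw [Finset.prod_range]
      exact lintegral_prod_eq_prod_lintegral_of_indepFun Finset.univ _
        (hind.comp (fun i : Fin (4 ^ n) => cellFactor _ j (i : ℕ)) fun i => Measurable.of_discrete)
        (fun i => hmeas j i)
    rw [h1, Finset.prod_congr rfl (fun i _ => lintegral_cellFactor hU hV0 hV1 n j i),
      prod_gridWeights (ψ := fun i => 1 - V (j / (i + 1))) (fun i => by linarith [hV1 (j / (i + 1))])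
        (by positivity) hj, lintegral_comp_cell n (gridFun _ n j),
      tsum_eq_sum (s := Finset.range (4 ^ n)) (fun i hi => by
        rw [gridFun, if_neg (fun h => hi (Finset.mem_range.2 h.2)), zero_mul])]
    have h2 : ∀ i ∈ Finset.range (4 ^ n), (if j < i then
        ENNReal.ofReal (1 - V (j / (i + 1))) * ENNReal.ofReal (1 / 2 ^ n) else 0) =
        gridFun (fun t => ENNReal.ofReal (1 - V t)) n j i * ENNReal.ofReal (1 / 2 ^ n) := by
      intro i hi
      have hi := Finset.mem_range.1 hi
      unfold gridFun
      split_ifs <;> simp_all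
    rw [Finset.sum_congr rfl h2, mul_one_div]
    ring
  rw [Finset.sum_congr rfl fun j hj => hprod j (Finset.mem_range.1 hj)]
  rw [lintegral_comp_cell n (fun j => if j < 4 ^ n then
        w (j / 2 ^ n) * ENNReal.ofReal (Real.exp (-((j + 1) / 2 ^ n))) *
          expNeg (∫⁻ x in Ici (0 : ℝ),
            gridFun (fun t => ENNReal.ofReal (1 - V t)) n j (cell n x)) else 0),
    tsum_eq_sum (s := Finset.range (4 ^ n)) (fun j hj => by
        rw [if_neg (fun h => hj (Finset.mem_range.2 h)), zero_mul])]
  refine Finset.sum_congr rfl fun j hj => ?_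
  rw [if_pos (Finset.mem_range.1 hj)]

/-- The integral of the discretised functional converges. -/
theorem tendsto_lintegral_gridSum (hU : IsPoissonProcess (volume.restrict (Ici (0 : ℝ))) U Pr)
    {V : ℝ → ℝ} (hVc : Continuous V) (hVm : AntitoneOn V (Ici 0)) (hV0 : ∀ t, 0 < V t)
    (hV1 : ∀ t, V t ≤ 1) {w : ℝ → ℝ≥0∞} (hw : Continuous w) (hw1 : ∀ t, w t ≤ 1) :
    Tendsto (fun n => ∫⁻ ω, gridSum U (fun t => ENNReal.ofReal (-Real.log (V t))) w n ω ∂Pr) atTop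
      (𝓝 (∫⁻ u in Ioi (0 : ℝ), w u * ENNReal.ofReal (Real.exp (-u)) *
        expNeg (∫⁻ x in Ioi u, ENNReal.ofReal (1 - V (u / x))))) := by
  simp_rw [lintegral_gridSum hU hV0 hV1, ← restrict_Ioi_eq_restrict_Ici]
  have hψc : Continuous fun t => ENNReal.ofReal (1 - V t) :=
    ENNReal.continuous_ofReal.comp (continuous_const.sub hVc)
  have hψm : MonotoneOn (fun t => ENNReal.ofReal (1 - V t)) (Ici 0) := fun s hs t ht hst =>
    ENNReal.ofReal_le_ofReal (by linarith [hVm hs ht hst])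
  refine tendsto_lintegral_of_dominated_convergence' (fun u => ENNReal.ofReal (Real.exp (-u)))
    (fun n => ?_) (fun n => ?_) ?_ ?_
  · have : (fun u : ℝ => if cell n u < 4 ^ n then
        w (cell n u / 2 ^ n) * ENNReal.ofReal (Real.exp (-((cell n u + 1) / 2 ^ n))) *
          expNeg (∫⁻ x in Ioi (0 : ℝ),
            gridFun (fun t => ENNReal.ofReal (1 - V t)) n (cell n u) (cell n x)) else 0) =
        (fun j : ℕ => if j < 4 ^ n then
        w (j / 2 ^ n) * ENNReal.ofReal (Real.exp (-((j + 1) / 2 ^ n))) *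
          expNeg (∫⁻ x in Ioi (0 : ℝ),
            gridFun (fun t => ENNReal.ofReal (1 - V t)) n j (cell n x)) else 0) ∘ cell n := rfl
    rw [this]
    exact (Measurable.of_discrete.comp (measurable_cell n)).aemeasurable
  · filter_upwards with u
    split_ifs
    · refine (mul_le_of_le_one_right' (expNeg_le_one _)).trans
        ((mul_le_of_le_one_left' (hw1 _)).trans (ENNReal.ofReal_le_ofReal ?_))
      gcongr
      -- The right end of the cell dominates `u`, so `exp (-u)` is a uniform integrable bound.
      rw [le_div_iff₀ (by positivity), mul_comm]
      exact (Nat.lt_floor_add_one _).le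
    · exact zero_le
  · rw [← ofReal_integral_eq_lintegral_ofReal (integrableOn_exp_neg_Ioi 0)
      (ae_of_all _ fun _ => (Real.exp_pos _).le)]
    exact ENNReal.ofReal_ne_top
  · filter_upwards [ae_restrict_mem measurableSet_Ioi] with u hu
    have hu : 0 < u := hu
    have h1 : Tendsto (fun n => w ((cell n u : ℝ) / 2 ^ n)) atTop (𝓝 (w u)) :=
      (hw.tendsto _).comp (tendsto_cell_div hu.le)
    have h2 : Tendsto (fun n => ENNReal.ofReal (Real.exp (-(((cell n u : ℝ) + 1) / 2 ^ n)))) atTop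
        (𝓝 (ENNReal.ofReal (Real.exp (-u)))) :=
      ENNReal.tendsto_ofReal ((Real.continuous_exp.tendsto _).comp (tendsto_cell_add_one_div hu.le).neg)
    have h3 : Tendsto (fun n => ∫⁻ x in Ioi (0 : ℝ),
        gridFun (fun t => ENNReal.ofReal (1 - V t)) n (cell n u) (cell n x)) atTop
        (𝓝 (∫⁻ x in Ioi u, ENNReal.ofReal (1 - V (u / x)))) := by
      have h4 : ∫⁻ x in Ioi u, ENNReal.ofReal (1 - V (u / x)) =
          ∫⁻ x in Ioi (0 : ℝ), if u < x then ENNReal.ofReal (1 - V (u / x)) else 0 := by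
        have : (fun x => if u < x then ENNReal.ofReal (1 - V (u / x)) else 0) =
            (Ioi u).indicator fun x => ENNReal.ofReal (1 - V (u / x)) := by
          ext x
          simp [indicator]
        rw [this, lintegral_indicator measurableSet_Ioi, Measure.restrict_restrict measurableSet_Ioi,
          inter_eq_left.2 (Ioi_subset_Ioi hu.le)]
      rw [h4]
      refine lintegral_tendsto_of_tendsto_of_monotone
        (fun n => ((Measurable.of_discrete (f := gridFun _ n (cell n u))).comp
          (measurable_cell n)).aemeasurable)
        (ae_of_all _ fun x => monotone_gridFun hψm u x) ?_
      filter_upwards [ae_restrict_mem measurableSet_Ioi] with x hx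
      exact tendsto_gridFun hψc hu.le (le_of_lt hx)
    have h5 := (continuous_expNeg.tendsto _).comp h3
    have h6 := ENNReal.Tendsto.mul (ENNReal.Tendsto.mul h1 (.inr ENNReal.ofReal_ne_top) h2
      (.inr ((hw1 u).trans_lt ENNReal.one_lt_top).ne)) (.inr ?_) h5 (.inr ?_)
    · refine h6.congr' ?_
      filter_upwards [eventually_cell_lt hu.le] with n hn
      rw [if_pos hn]
      rfl
    · exact ((expNeg_le_one _).trans_lt ENNReal.one_lt_top).ne
    · exact ENNReal.mul_ne_top ((hw1 u).trans_lt ENNReal.one_lt_top).ne ENNReal.ofReal_ne_top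

/-- Almost surely, a Poisson process on the half-line has a unique smallest point. -/
theorem ae_exists_isolated [IsProbabilityMeasure Pr]
    (hU : IsPoissonProcess (volume.restrict (Ici (0 : ℝ))) U Pr) :
    ∀ᵐ ω ∂Pr, ∃ n k, Isolated U n ω k := by
  -- With `V = w = 1` the means tend to `∫ e^{-u} du = 1`, while `gridSum` is at most the indicator
  -- of `S`, the event that some grid isolates a point. Hence `S` has full measure.
  have h := tendsto_lintegral_gridSum hU (V := fun _ => 1) (w := fun _ => 1) continuous_const
    (fun _ _ _ _ _ => le_rfl) (fun _ => one_pos) (fun _ => le_rfl) continuous_const (fun _ => le_rfl)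
  have hone : ∫⁻ u in Ioi (0 : ℝ), 1 * ENNReal.ofReal (Real.exp (-u)) *
        expNeg (∫⁻ x in Ioi u, ENNReal.ofReal (1 - 1)) = 1 := by
    simp only [sub_self, ENNReal.ofReal_zero, lintegral_zero, expNeg_zero, mul_one, one_mul]
    rw [← ofReal_integral_eq_lintegral_ofReal (integrableOn_exp_neg_Ioi 0)
      (ae_of_all _ fun _ => (Real.exp_pos _).le), integral_exp_neg_Ioi_zero, ENNReal.ofReal_one]
  rw [hone] at h
  set S : Set Ω := ⋃ n, {ω | gridSum U (fun t => ENNReal.ofReal (-Real.log 1)) (fun _ => 1) n ω ≠ 0}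
  have hS : MeasurableSet S := MeasurableSet.iUnion fun n =>
    measurable_gridSum hU.measurable _ _ n (measurableSet_singleton 0).compl
  have hle : 1 ≤ Pr S := by
    refine le_of_tendsto h (Eventually.of_forall fun n => ?_)
    rw [← lintegral_indicator_one hS]
    refine lintegral_mono fun ω => ?_
    by_cases hω : ω ∈ S
    · rw [indicator_of_mem hω]
      exact gridSum_le_one (fun _ => le_rfl) n ω
    · rw [indicator_of_notMem hω]
      have : gridSum U (fun t => ENNReal.ofReal (-Real.log 1)) (fun _ => 1) n ω = 0 := by
        by_contra hc
        exact hω (mem_iUnion.2 ⟨n, hc⟩)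
      exact this.le
  have hae : ∀ᵐ ω ∂Pr, ω ∈ S := by
    rw [ae_iff, ← compl_def, prob_compl_eq_zero_iff hS]
    exact le_antisymm prob_le_one hle
  filter_upwards [hae] with ω hω
  obtain ⟨n, hn⟩ := mem_iUnion.1 hω
  exact ⟨n, exists_isolated_of_gridSum_ne_zero hn⟩

/-- Laplace functional of a unit rate Poisson process on the half-line seen from its smallest
point. -/
theorem lintegral_nearest [IsProbabilityMeasure Pr]
    (hU : IsPoissonProcess (volume.restrict (Ici (0 : ℝ))) U Pr) (hUnn : ∀ k ω, 0 ≤ U k ω)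
    {star : Ω → ℕ} (hstar : ∀ᵐ ω ∂Pr, ∀ k, U (star ω) ω ≤ U k ω)
    {V : ℝ → ℝ} (hVc : Continuous V) (hVm : AntitoneOn V (Ici 0)) (hV0 : ∀ t, 0 < V t)
    (hV1 : ∀ t, V t ≤ 1) {w : ℝ → ℝ≥0∞} (hw : Continuous w) (hw1 : ∀ t, w t ≤ 1) :
    ∫⁻ ω, w (U (star ω) ω) * expNeg (∑' k, if k = star ω then 0 else
        ENNReal.ofReal (-Real.log (V (U (star ω) ω / U k ω)))) ∂Pr =
      ∫⁻ u in Ioi (0 : ℝ), w u * ENNReal.ofReal (Real.exp (-u)) *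
        expNeg (∫⁻ x in Ioi u, ENNReal.ofReal (1 - V (u / x))) := by
  refine tendsto_nhds_unique ?_ (tendsto_lintegral_gridSum hU hVc hVm hV0 hV1 hw hw1)
  refine tendsto_lintegral_of_dominated_convergence (fun _ => 1)
    (fun n => measurable_gridSum hU.measurable _ _ n)
    (fun n => ae_of_all _ fun ω => gridSum_le_one hw1 n ω) (by simp) ?_
  filter_upwards [hstar, ae_exists_isolated hU] with ω h1 h2
  obtain ⟨n, k, hk⟩ := h2
  have : star ω = k := by
    by_contra hne
    exact absurd (h1 k) (not_le.2 (hk.lt hne))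
  rw [this]
  refine hk.tendsto_gridSum (fun k => hUnn k ω) ?_ ?_ hw hw1
  · exact ENNReal.continuous_ofReal.comp (hVc.log fun t => (hV0 t).ne').neg
  · exact fun s hs t ht hst => ENNReal.ofReal_le_ofReal
      (neg_le_neg (Real.log_le_log (hV0 t) (hVm hs ht hst)))

end Nearest

/-! ### Fading distributions -/

theorem lintegral_exp_neg_sq_gaussianReal (v : ℝ≥0) {t : ℝ} (ht : 0 ≤ t) :
    ∫⁻ x, ENNReal.ofReal (Real.exp (-(t * x ^ 2))) ∂gaussianReal 0 v =
      ENNReal.ofReal (1 / √(1 + 2 * t * v)) := by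
  by_cases hv : v = 0
  · subst hv
    simp
  have hv' : (0 : ℝ) < v := by positivity
  rw [gaussianReal_of_var_ne_zero _ hv, lintegral_withDensity_eq_lintegral_mul _
    (measurable_gaussianPDF 0 v) (by fun_prop)]
  set b : ℝ := t + 1 / (2 * v) with hb
  have hb0 : 0 < b := by positivity
  have h1 : ∀ x : ℝ, (gaussianPDF 0 v * fun x => ENNReal.ofReal (Real.exp (-(t * x ^ 2)))) x =
      ENNReal.ofReal ((√(2 * Real.pi * v))⁻¹ * Real.exp (-b * x ^ 2)) := by
    intro x
    rw [Pi.mul_apply, gaussianPDF, ← ENNReal.ofReal_mul (gaussianPDFReal_nonneg _ _ _), gaussianPDFReal,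
      mul_assoc, ← Real.exp_add]
    congr 3
    rw [hb]
    field_simp
    ring
  simp_rw [h1]
  rw [← ofReal_integral_eq_lintegral_ofReal ((integrable_exp_neg_mul_sq hb0).const_mul _)
    (ae_of_all _ fun x => by positivity), integral_const_mul, integral_gaussian]
  congr 1
  rw [← Real.sqrt_inv, ← Real.sqrt_mul (by positivity), one_div, ← Real.sqrt_inv]
  congr 1
  have := Real.pi_pos
  rw [hb]
  field_simp
  ring

/-- Scaled centred Gaussians are Gaussian, and variances add under convolution. -/
theorem lintegral_gaussianReal_combination {v₁ v₂ : ℝ≥0} (a b : ℝ) {h : ℝ → ℝ≥0∞}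
    (hh : Measurable h) :
    ∫⁻ x, ∫⁻ y, h (a * x + b * y) ∂gaussianReal 0 v₂ ∂gaussianReal 0 v₁ =
      ∫⁻ x, h x ∂gaussianReal 0 ((a ^ 2).toNNReal * v₁ + (b ^ 2).toNNReal * v₂) := by
  have hm : ∀ (c : ℝ) (v : ℝ≥0), (gaussianReal 0 v).map (c * ·) =
      gaussianReal 0 ((c ^ 2).toNNReal * v) := by
    intro c v
    rw [gaussianReal_map_const_mul, mul_zero]
    congr 2
    ext
    simp [sq_nonneg]
  have := gaussianReal_conv_gaussianReal (m₁ := 0) (m₂ := 0) (v₁ := (a ^ 2).toNNReal * v₁)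
    (v₂ := (b ^ 2).toNNReal * v₂)
  rw [add_zero] at this
  rw [← this, Measure.lintegral_conv hh, ← hm, ← hm, lintegral_map (by fun_prop) (by fun_prop)]
  refine lintegral_congr fun x => ?_
  rw [lintegral_map (by fun_prop) (by fun_prop)]

theorem measurable_complex_mk : Measurable fun x : ℝ × ℝ => (⟨x.1, x.2⟩ : ℂ) :=
  Complex.measurableEquivRealProd.symm.measurable

instance isProbabilityMeasure_complexGaussian (v : ℝ≥0) :
    IsProbabilityMeasure (complexGaussian v) :=
  Measure.isProbabilityMeasure_map measurable_complex_mk.aemeasurable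

theorem lintegral_complexGaussian (v : ℝ≥0) {f : ℂ → ℝ≥0∞} (hf : Measurable f) :
    ∫⁻ z, f z ∂complexGaussian v =
      ∫⁻ x, f ⟨x.1, x.2⟩ ∂(gaussianReal 0 (v / 2)).prod (gaussianReal 0 (v / 2)) :=
  lintegral_map hf measurable_complex_mk

theorem complex_norm_sq (x y : ℝ) : ‖(⟨x, y⟩ : ℂ)‖ ^ 2 = x ^ 2 + y ^ 2 := by
  rw [Complex.sq_norm, Complex.normSq_mk]
  ring

/-- Laplace transform of the power of a combination of independent circular Gaussians. -/
theorem lintegral_exp_neg_norm_sq_complexGaussian (v₁ v₂ : ℝ≥0) (a b : ℝ) {t : ℝ} (ht : 0 ≤ t) :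
    ∫⁻ z, ∫⁻ z', ENNReal.ofReal (Real.exp (-(t * ‖(a : ℂ) * z + (b : ℂ) * z'‖ ^ 2)))
        ∂complexGaussian v₂ ∂complexGaussian v₁ =
      ENNReal.ofReal (1 / (1 + t * (a ^ 2 * v₁ + b ^ 2 * v₂))) := by
  set k : ℝ → ℝ≥0∞ := fun x => ENNReal.ofReal (Real.exp (-(t * x ^ 2)))
  have hk : Measurable k := by fun_prop
  -- The coefficients are real, so the power splits into real and imaginary parts, which are
  -- independent; each gives the square root of the final factor.
  have h1 : ∀ x y : ℝ × ℝ, ENNReal.ofReal (Real.exp (-(t *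
      ‖(a : ℂ) * (⟨x.1, x.2⟩ : ℂ) + (b : ℂ) * (⟨y.1, y.2⟩ : ℂ)‖ ^ 2))) =
      k (a * x.1 + b * y.1) * k (a * x.2 + b * y.2) := by
    intro x y
    have : (a : ℂ) * (⟨x.1, x.2⟩ : ℂ) + (b : ℂ) * (⟨y.1, y.2⟩ : ℂ) =
        ⟨a * x.1 + b * y.1, a * x.2 + b * y.2⟩ := by
      apply Complex.ext <;> simp
    rw [this, complex_norm_sq, ← ENNReal.ofReal_mul (Real.exp_pos _).le, ← Real.exp_add]
    congr 2
    ring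
  rw [lintegral_complexGaussian _ (Measurable.lintegral_prod_right' (f := fun p : ℂ × ℂ =>
    ENNReal.ofReal (Real.exp (-(t * ‖(a : ℂ) * p.1 + (b : ℂ) * p.2‖ ^ 2)))) (by fun_prop))]
  have h0 : ∀ z : ℂ, ∫⁻ z', ENNReal.ofReal (Real.exp (-(t * ‖(a : ℂ) * z + (b : ℂ) * z'‖ ^ 2)))
      ∂complexGaussian v₂ = ∫⁻ y : ℝ × ℝ, ENNReal.ofReal (Real.exp (-(t *
        ‖(a : ℂ) * z + (b : ℂ) * (⟨y.1, y.2⟩ : ℂ)‖ ^ 2)))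
        ∂(gaussianReal 0 (v₂ / 2)).prod (gaussianReal 0 (v₂ / 2)) := fun z =>
    lintegral_complexGaussian v₂ (by fun_prop)
  simp_rw [h0, h1]
  have h2 : ∀ x : ℝ × ℝ, ∫⁻ y : ℝ × ℝ, k (a * x.1 + b * y.1) * k (a * x.2 + b * y.2)
      ∂(gaussianReal 0 (v₂ / 2)).prod (gaussianReal 0 (v₂ / 2)) =
      (∫⁻ y, k (a * x.1 + b * y) ∂gaussianReal 0 (v₂ / 2)) *
      ∫⁻ y, k (a * x.2 + b * y) ∂gaussianReal 0 (v₂ / 2) := fun x =>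
    lintegral_prod_mul (f := fun y => k (a * x.1 + b * y)) (g := fun y => k (a * x.2 + b * y))
      (by fun_prop) (by fun_prop)
  simp_rw [h2]
  have hq : Measurable fun x => ∫⁻ y, k (a * x + b * y) ∂gaussianReal 0 (v₂ / 2) :=
    Measurable.lintegral_prod_right' (f := fun p : ℝ × ℝ => k (a * p.1 + b * p.2)) (by fun_prop)
  rw [lintegral_prod_mul (f := fun x => ∫⁻ y, k (a * x + b * y) ∂gaussianReal 0 (v₂ / 2))
    (g := fun x => ∫⁻ y, k (a * x + b * y) ∂gaussianReal 0 (v₂ / 2)) hq.aemeasurable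
    hq.aemeasurable, lintegral_gaussianReal_combination a b hk,
    lintegral_exp_neg_sq_gaussianReal _ ht, ← ENNReal.ofReal_mul (by positivity)]
  congr 1
  rw [div_mul_div_comm, one_mul, Real.mul_self_sqrt (by positivity)]
  congr 1
  push_cast
  rw [Real.coe_toNNReal _ (sq_nonneg a), Real.coe_toNNReal _ (sq_nonneg b)]
  ring

/-- In polar coordinates the radial density `r exp (-r²)` has an elementary primitive, so `‖z‖²` is
a unit exponential. -/
theorem complexGaussian_one_tail {t : ℝ} (ht : 0 ≤ t) :
    complexGaussian 1 {z | t < ‖z‖ ^ 2} = ENNReal.ofReal (Real.exp (-t)) := by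
  have hS : MeasurableSet {z : ℂ | t < ‖z‖ ^ 2} := measurableSet_lt (by fun_prop) (by fun_prop)
  have hS' : MeasurableSet {z : ℝ × ℝ | t < z.1 ^ 2 + z.2 ^ 2} :=
    measurableSet_lt (by fun_prop) (by fun_prop)
  have hd : ∀ p : ℝ × ℝ, gaussianPDF 0 (1 / 2) p.1 * gaussianPDF 0 (1 / 2) p.2 =
      ENNReal.ofReal (1 / Real.pi * Real.exp (-(p.1 ^ 2 + p.2 ^ 2))) := by
    intro p
    rw [gaussianPDF, gaussianPDF, ← ENNReal.ofReal_mul (gaussianPDFReal_nonneg _ _ _)]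
    congr 1
    have hpi := Real.pi_pos
    simp only [gaussianPDFReal, NNReal.coe_div, NNReal.coe_one, NNReal.coe_ofNat, sub_zero]
    rw [show (2 : ℝ) * Real.pi * (1 / 2) = Real.pi by ring, show (2 : ℝ) * (1 / 2) = 1 by ring]
    rw [mul_mul_mul_comm, ← Real.exp_add, ← mul_inv, Real.mul_self_sqrt hpi.le]
    congr 1
    · ring
    · congr 1
      ring
  have hv : (1 / 2 : ℝ≥0) ≠ 0 := by norm_num
  rw [complexGaussian, Measure.map_apply measurable_complex_mk hS, gaussianReal_of_var_ne_zero _ hv,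
    prod_withDensity (measurable_gaussianPDF _ _) (measurable_gaussianPDF _ _)]
  have hpre : (fun x : ℝ × ℝ => (⟨x.1, x.2⟩ : ℂ)) ⁻¹' {z | t < ‖z‖ ^ 2} =
      {z : ℝ × ℝ | t < z.1 ^ 2 + z.2 ^ 2} := by
    ext x
    simp only [mem_preimage, mem_ofPred_eq, complex_norm_sq]
  rw [hpre, withDensity_apply _ hS', ← Measure.volume_eq_prod]
  simp_rw [hd]
  rw [← lintegral_indicator hS', ← lintegral_comp_polarCoord_symm, polarCoord_target]
  have h1 : ∀ p ∈ Ioi (0 : ℝ) ×ˢ Ioo (-Real.pi) Real.pi, ENNReal.ofReal p.1 •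
      {z : ℝ × ℝ | t < z.1 ^ 2 + z.2 ^ 2}.indicator (fun a => ENNReal.ofReal
        (1 / Real.pi * Real.exp (-(a.1 ^ 2 + a.2 ^ 2)))) (polarCoord.symm p) =
      (Ioi √t).indicator (fun r => ENNReal.ofReal (1 / Real.pi * (r * Real.exp (-r ^ 2)))) p.1 * 1 := by
    rintro ⟨r, θ⟩ ⟨hr, -⟩
    have hr : 0 < r := hr
    have e : (r * Real.cos θ) ^ 2 + (r * Real.sin θ) ^ 2 = r ^ 2 := by
      rw [mul_pow, mul_pow, ← mul_add, Real.cos_sq_add_sin_sq, mul_one]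
    simp only [indicator, mem_ofPred_eq, polarCoord_symm_apply, e, mem_Ioi, smul_eq_mul, mul_one]
    simp only [← Real.sqrt_lt' hr]
    split_ifs
    · rw [← ENNReal.ofReal_mul hr.le]
      congr 1
      ring
    · simp
  rw [setLIntegral_congr_fun (measurableSet_Ioi.prod measurableSet_Ioo) h1, Measure.volume_eq_prod,
    ← Measure.prod_restrict, lintegral_prod_mul (g := fun _ => (1 : ℝ≥0∞))
      (Measurable.indicator (by fun_prop) measurableSet_Ioi).aemeasurable (by fun_prop)]
  rw [lintegral_indicator measurableSet_Ioi, Measure.restrict_restrict measurableSet_Ioi,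
    inter_eq_left.2 (Ioi_subset_Ioi (Real.sqrt_nonneg t)), lintegral_one, Measure.restrict_apply_univ,
    Real.volume_Ioo]
  have hder : ∀ x ∈ Ici √t, HasDerivAt (fun r : ℝ => -(1 / (2 * Real.pi)) * Real.exp (-r ^ 2))
      (1 / Real.pi * (x * Real.exp (-x ^ 2))) x := by
    intro x _
    have := ((hasDerivAt_pow 2 x).neg.exp).const_mul (-(1 / (2 * Real.pi)))
    convert! this using 1
    simp only [Pi.neg_apply]
    push_cast
    field_simp
  have hlim : Tendsto (fun r : ℝ => -(1 / (2 * Real.pi)) * Real.exp (-r ^ 2)) atTop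
      (𝓝 (-(1 / (2 * Real.pi)) * 0)) :=
    (Real.tendsto_exp_atBot.comp
      (tendsto_neg_atTop_atBot.comp (tendsto_pow_atTop two_ne_zero))).const_mul _
  have hnn : ∀ x ∈ Ioi √t, 0 ≤ 1 / Real.pi * (x * Real.exp (-x ^ 2)) := by
    intro x hx
    have : 0 ≤ x := (Real.sqrt_nonneg t).trans (le_of_lt hx)
    have := Real.pi_pos
    positivity
  have hint := integrableOn_Ioi_deriv_of_nonneg' hder hnn hlim
  rw [← ofReal_integral_eq_lintegral_ofReal hint
      (by filter_upwards [ae_restrict_mem measurableSet_Ioi] with x hx using hnn x hx),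
    integral_Ioi_of_hasDerivAt_of_tendsto' hder hint hlim, ← ENNReal.ofReal_mul, Real.sq_sqrt ht]
  · congr 1
    have := Real.pi_pos
    field_simp
    ring
  · rw [Real.sq_sqrt ht]
    have := Real.pi_pos
    have : 0 < 1 / (2 * Real.pi) * Real.exp (-t) := by positivity
    linarith

/-- Differentiation telescopes the sum, leaving the density of the gamma law of shape `k + 1`. -/
theorem hasDerivAt_poisson_tail (k : ℕ) (x : ℝ) :
    HasDerivAt (fun x : ℝ => -(∑ i ∈ Finset.range (k + 1), x ^ i / i.factorial) * Real.exp (-x))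
      (x ^ k / k.factorial * Real.exp (-x)) x := by
  induction k with
  | zero =>
    have h := ((hasDerivAt_neg x).exp).neg
    convert! h using 1
    · funext y
      simp
    · simp
  | succ k ih =>
    have hd : HasDerivAt (fun x : ℝ => -(x ^ (k + 1) / (k + 1).factorial) * Real.exp (-x))
        (-((k + 1 : ℕ) * x ^ k / (k + 1).factorial) * Real.exp (-x) +
          -(x ^ (k + 1) / (k + 1).factorial) * (Real.exp (-x) * -1)) x :=
      (((hasDerivAt_pow (k + 1) x).div_const _).neg).mul (hasDerivAt_neg x).exp
    convert! ih.add hd using 1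
    · funext y
      simp only [Pi.add_apply]
      rw [Finset.sum_range_succ _ (k + 1)]
      ring
    · rw [Nat.factorial_succ]
      push_cast
      have : (k.factorial : ℝ) ≠ 0 := by positivity
      have : (k : ℝ) + 1 ≠ 0 := by positivity
      field_simp
      ring

/-- The tail of a gamma distribution of integer shape. -/
theorem gammaMeasure_tail {k : ℕ} (hk : 0 < k) {t : ℝ} (ht : 0 ≤ t) :
    gammaMeasure k 1 {x | t < x} =
      ENNReal.ofReal ((∑ i ∈ Finset.range k, t ^ i / i.factorial) * Real.exp (-t)) := by
  obtain ⟨k, rfl⟩ := Nat.exists_eq_succ_of_ne_zero hk.ne'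
  change gammaMeasure _ 1 (Ioi t) = _
  rw [gammaMeasure, withDensity_apply _ measurableSet_Ioi]
  have h1 : ∀ x ∈ Ioi t, gammaPDF ((k.succ : ℕ) : ℝ) 1 x =
      ENNReal.ofReal (x ^ k / k.factorial * Real.exp (-x)) := by
    intro x hx
    have hx : 0 < x := ht.trans_lt hx
    rw [gammaPDF_of_nonneg hx.le]
    congr 1
    simp only [Nat.succ_eq_add_one, Nat.cast_add, Nat.cast_one, Real.one_rpow, one_mul,
      Real.Gamma_nat_eq_factorial, add_sub_cancel_right, Real.rpow_natCast]
    ring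
  rw [setLIntegral_congr_fun measurableSet_Ioi h1]
  have hlim : Tendsto (fun x : ℝ => -(∑ i ∈ Finset.range (k + 1), x ^ i / i.factorial) * Real.exp (-x))
      atTop (𝓝 0) := by
    have h2 : Tendsto (fun x : ℝ => -∑ i ∈ Finset.range (k + 1),
        (x ^ i * Real.exp (-x)) * (i.factorial : ℝ)⁻¹) atTop
        (𝓝 (-∑ i ∈ Finset.range (k + 1), 0 * (i.factorial : ℝ)⁻¹)) :=
      (tendsto_finsetSum _ fun i _ => (Real.tendsto_pow_mul_exp_neg_atTop_nhds_zero i).mul_const _).neg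
    simp only [zero_mul, Finset.sum_const_zero, neg_zero] at h2
    refine h2.congr fun x => ?_
    rw [neg_mul, Finset.sum_mul]
    congr 1
    refine Finset.sum_congr rfl fun i _ => ?_
    ring
  have hnn : ∀ x ∈ Ioi t, 0 ≤ x ^ k / k.factorial * Real.exp (-x) := by
    intro x hx
    have : 0 ≤ x := ht.trans (le_of_lt hx)
    positivity
  have hint := integrableOn_Ioi_deriv_of_nonneg' (fun x _ => hasDerivAt_poisson_tail k x) hnn hlim
  rw [← ofReal_integral_eq_lintegral_ofReal hint
      (by filter_upwards [ae_restrict_mem measurableSet_Ioi] with x hx using hnn x hx),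
    integral_Ioi_of_hasDerivAt_of_tendsto' (fun x _ => hasDerivAt_poisson_tail k x) hint hlim]
  congr 1
  ring

/-! ### Independent identically distributed marks -/

section Marks

variable {α : Type*} [MeasurableSpace α] {μ : Measure α} [IsProbabilityMeasure μ]

/-- Independence handles finite partial sums; bounded convergence and continuity of `expNeg` give
the series, divergent or not. -/
theorem lintegral_infinitePi_expNeg_tsum {a : ℕ → α → ℝ≥0∞} (ha : ∀ k, Measurable (a k))
    {l : ℕ → ℝ≥0∞} (hl : ∀ k, ∫⁻ x, expNeg (a k x) ∂μ = expNeg (l k)) :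
    ∫⁻ m, expNeg (∑' k, a k (m k)) ∂Measure.infinitePi (fun _ : ℕ => μ) = expNeg (∑' k, l k) := by
  have hfin : ∀ n : ℕ, ∫⁻ m, expNeg (∑ k ∈ Finset.range n, a k (m k))
      ∂Measure.infinitePi (fun _ : ℕ => μ) = expNeg (∑ k ∈ Finset.range n, l k) := by
    intro n
    simp_rw [expNeg_sum]
    rw [lintegral_prod_eq_prod_lintegral_of_indepFun (Finset.range n)
      (fun k (m : ℕ → α) => expNeg (a k (m k)))
      (iIndepFun_infinitePi (P := fun _ : ℕ => μ) (X := fun k x => expNeg (a k x))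
        (fun k => measurable_expNeg.comp (ha k)))
      (fun k => measurable_expNeg.comp ((ha k).comp (measurable_pi_apply k)))]
    refine Finset.prod_congr rfl fun k _ => ?_
    rw [← hl k]
    exact (measurePreserving_eval_infinitePi (fun _ : ℕ => μ) k).lintegral_comp
      (measurable_expNeg.comp (ha k))
  have h1 : Tendsto (fun n : ℕ => expNeg (∑ k ∈ Finset.range n, l k)) atTop
      (𝓝 (expNeg (∑' k, l k))) :=
    (continuous_expNeg.tendsto _).comp ENNReal.summable.hasSum.tendsto_sum_nat
  refine tendsto_nhds_unique ?_ h1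
  simp_rw [← hfin]
  refine tendsto_lintegral_of_dominated_convergence (fun _ => 1) (fun n => ?_)
    (fun n => ae_of_all _ fun m => expNeg_le_one _) (by simp) (ae_of_all _ fun m => ?_)
  · exact measurable_expNeg.comp
      (Finset.measurable_sum _ fun k _ => (ha k).comp (measurable_pi_apply k))
  · exact (continuous_expNeg.tendsto _).comp ENNReal.summable.hasSum.tendsto_sum_nat

theorem measurable_tsum_ite {β : Type*} {_ : MeasurableSpace β} {g : ℕ → β → ℝ≥0∞} {n : ℕ}
    (hg : ∀ k, k ≠ n → Measurable (g k)) :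
    Measurable fun m => ∑' k, if k = n then 0 else g k m := by
  refine Measurable.tsum fun k => ?_
  split_ifs with hk
  · exact measurable_const
  · exact hg k hk

/-- The `n`-th coordinate is independent of a sum that omits it, so it may be replaced by a fresh
copy. Later, `n` is the server and the sum is the interference. -/
theorem lintegral_infinitePi_eval_tsum {a : ℕ → α → ℝ≥0∞} (ha : ∀ k, Measurable (a k)) (n : ℕ)
    {H : α × ℝ≥0∞ → ℝ≥0∞} (hH : Measurable H) :
    ∫⁻ m, H (m n, ∑' k, if k = n then 0 else a k (m k)) ∂Measure.infinitePi (fun _ : ℕ => μ) =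
      ∫⁻ m, ∫⁻ x, H (x, ∑' k, if k = n then 0 else a k (m k)) ∂μ
        ∂Measure.infinitePi (fun _ : ℕ => μ) := by
  set P := Measure.infinitePi (fun _ : ℕ => μ)
  set R : (ℕ → α) → ℝ≥0∞ := fun m => ∑' k, if k = n then 0 else a k (m k) with hR
  have hRm : Measurable R :=
    measurable_tsum_ite fun k _ => (ha k).comp (measurable_pi_apply k)
  have hind : IndepFun (fun m : ℕ → α => m n) R P := by
    have h1 : iIndepFun (fun k (m : ℕ → α) => m k) P :=
      iIndepFun_infinitePi (P := fun _ : ℕ => μ) (X := fun _ x => x) (fun _ => measurable_id)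
    have h2 := indep_iSup_of_disjoint (fun k => (measurable_pi_apply k).comap_le) h1.iIndep
      (S := {n}) (T := {n}ᶜ) disjoint_compl_right
    refine indep_of_indep_of_le_left (indep_of_indep_of_le_right h2 ?_) ?_
    · rw [← measurable_iff_comap_le]
      refine measurable_tsum_ite fun k hk => (ha k).comp ?_
      rw [measurable_iff_comap_le]
      exact le_iSup₂_of_le k hk le_rfl
    · exact le_iSup₂_of_le n rfl le_rfl
  have hmap := hind.map_prod_eq_prod_map_map (measurable_pi_apply n).aemeasurable hRm.aemeasurable
  have h3 : ∫⁻ m, H (m n, R m) ∂P = ∫⁻ z, H z ∂(P.map fun m => (m n, R m)) :=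
    (lintegral_map hH ((measurable_pi_apply n).prodMk hRm)).symm
  rw [h3, hmap, lintegral_prod_symm' _ hH, lintegral_map (Measurable.lintegral_prod_left' hH) hRm,
    (measurePreserving_eval_infinitePi (fun _ : ℕ => μ) n).map_eq]

/-- Derivatives of a Laplace transform on the positive half-line. -/
theorem laplace_derivatives {T : α → ℝ≥0∞} (hT : Measurable T) {f : ℝ → ℝ} (hf0 : ∀ s, 0 < s → 0 ≤ f s)
    (hf : ∀ s, 0 < s → ∫⁻ x, expNeg (ENNReal.ofReal s * T x) ∂μ = ENNReal.ofReal (f s)) :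
    ContDiffAt ℝ (⊤ : ℕ∞) f 1 ∧ ∀ i, 0 ≤ (-1) ^ i * iteratedDeriv i f 1 ∧
      ∫⁻ x, T x ^ i * expNeg (T x) ∂μ = ENNReal.ofReal ((-1) ^ i * iteratedDeriv i f 1) := by
  -- Where `T = ∞` all the integrands vanish, so `μ` may be restricted to finite `T`. There `f` is
  -- the moment generating function of `-T`, analytic in the interior of its domain, which contains
  -- `1`.
  have hS : MeasurableSet {x | T x ≠ ∞} := hT (measurableSet_singleton ∞).compl
  set ν := μ.restrict {x | T x ≠ ∞} with hν
  set Y : α → ℝ := fun x => -(T x).toReal with hY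
  have hYm : Measurable Y := hT.ennreal_toReal.neg
  have hint : ∀ s, 0 < s → Integrable (fun x => Real.exp (s * Y x)) ν := by
    intro s hs
    refine Integrable.of_bound (by fun_prop) 1 (ae_of_all _ fun x => ?_)
    rw [Real.norm_of_nonneg (Real.exp_pos _).le, Real.exp_le_one_iff, hY]
    have : 0 ≤ (T x).toReal := ENNReal.toReal_nonneg
    nlinarith
  have hae : ∀ᵐ x ∂ν, T x ≠ ∞ := ae_restrict_mem hS
  have hrestr : ∀ g : α → ℝ≥0∞, (∀ x, T x = ∞ → g x = 0) → ∫⁻ x, g x ∂μ = ∫⁻ x, g x ∂ν := by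
    intro g hg
    rw [hν, ← lintegral_indicator hS]
    refine lintegral_congr fun x => ?_
    by_cases hx : T x = ∞
    · rw [hg x hx, indicator_of_notMem (by simpa using hx)]
    · rw [indicator_of_mem hx]
  have hmgf : ∀ s, 0 < s → mgf Y ν s = f s := by
    intro s hs
    rw [mgf, ← ENNReal.ofReal_eq_ofReal_iff (integral_nonneg fun x => (Real.exp_pos _).le) (hf0 s hs),
      ← hf s hs, hrestr _ (fun x hx => by
        rw [hx, ENNReal.mul_top (by simpa using hs), expNeg_top]),
      ofReal_integral_eq_lintegral_ofReal (hint s hs) (ae_of_all _ fun x => (Real.exp_pos _).le)]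
    refine lintegral_congr_ae ?_
    filter_upwards [hae] with x hx
    rw [expNeg_eq_of_ne_top (ENNReal.mul_ne_top ENNReal.ofReal_ne_top hx), ENNReal.toReal_mul,
      ENNReal.toReal_ofReal hs.le, hY]
    congr 2
    ring
  have hmem : (1 : ℝ) ∈ interior (integrableExpSet Y ν) := by
    refine mem_interior.2 ⟨Ioi 0, fun s hs => hint s hs, isOpen_Ioi, mem_Ioi.2 one_pos⟩
  have heq : mgf Y ν =ᶠ[𝓝 1] f := by
    filter_upwards [Ioi_mem_nhds one_pos] with s hs using hmgf s hs
  refine ⟨(analyticAt_mgf hmem).contDiffAt.congr_of_eventuallyEq heq.symm, fun i => ?_⟩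
  have hder : (-1) ^ i * iteratedDeriv i f 1 = ∫ x, (T x).toReal ^ i * Real.exp (-(T x).toReal) ∂ν := by
    rw [← heq.iteratedDeriv_eq i, iteratedDeriv_mgf hmem, ← integral_const_mul]
    refine integral_congr_ae (ae_of_all _ fun x => ?_)
    simp only [hY, one_mul]
    rw [← mul_assoc, ← mul_pow]
    ring_nf
  have hnn : ∀ x, 0 ≤ (T x).toReal ^ i * Real.exp (-(T x).toReal) := fun x => by positivity
  rw [hder]
  refine ⟨integral_nonneg hnn, ?_⟩
  have hi : Integrable (fun x => (T x).toReal ^ i * Real.exp (-(T x).toReal)) ν := by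
    have := (integrable_pow_mul_exp_of_mem_interior_integrableExpSet hmem i).norm
    refine this.congr (ae_of_all _ fun x => ?_)
    simp [hY]
  rw [ofReal_integral_eq_lintegral_ofReal hi (ae_of_all _ hnn), hrestr _ (fun x hx => by simp [hx])]
  refine lintegral_congr_ae ?_
  filter_upwards [hae] with x hx
  rw [expNeg_eq_of_ne_top hx, ENNReal.ofReal_mul (by positivity), ENNReal.ofReal_pow (by positivity),
    ENNReal.ofReal_toReal hx]

end Marks

/-! ### Laws of the signal and of a single interferer. -/

/-- The tail of the gamma distribution of integer shape `k` and unit scale, on `[0, ∞]`. -/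
def gammaTail (k : ℕ) (t : ℝ≥0∞) : ℝ≥0∞ :=
  ∑ i ∈ Finset.range k, ENNReal.ofReal (i.factorial : ℝ)⁻¹ * (t ^ i * expNeg t)

theorem gammaMeasure_lt_ofReal {k : ℕ} (hk : 0 < k) (t : ℝ≥0∞) :
    gammaMeasure k 1 {x | t < ENNReal.ofReal x} = gammaTail k t := by
  by_cases ht : t = ∞
  · simp [ht, gammaTail]
  · lift t to ℝ≥0 using ht
    have h1 : {x : ℝ | (t : ℝ≥0∞) < ENNReal.ofReal x} = {x | (t : ℝ) < x} := by
      ext x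
      rw [mem_ofPred_eq, mem_ofPred_eq, ← ENNReal.ofReal_coe_nnreal, ENNReal.ofReal_lt_ofReal_iff']
      exact ⟨fun h => h.1, fun h => ⟨h, t.2.trans_lt h⟩⟩
    rw [h1, gammaMeasure_tail hk t.coe_nonneg, gammaTail, Finset.sum_mul,
      ENNReal.ofReal_sum_of_nonneg (fun i _ => by positivity)]
    refine Finset.sum_congr rfl fun i _ => ?_
    rw [← ENNReal.ofReal_coe_nnreal, expNeg_ofReal t.coe_nonneg, ← ENNReal.ofReal_pow t.coe_nonneg,
      ← ENNReal.ofReal_mul (by positivity), ← ENNReal.ofReal_mul (by positivity)]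
    congr 1
    ring

theorem complexGaussian_one_lt_ofReal (t : ℝ≥0∞) :
    complexGaussian 1 {z | t < ENNReal.ofReal (‖z‖ ^ 2)} = expNeg t := by
  by_cases ht : t = ∞
  · simp [ht]
  · lift t to ℝ≥0 using ht
    have h1 : {z : ℂ | (t : ℝ≥0∞) < ENNReal.ofReal (‖z‖ ^ 2)} = {z | (t : ℝ) < ‖z‖ ^ 2} := by
      ext x
      rw [mem_ofPred_eq, mem_ofPred_eq, ← ENNReal.ofReal_coe_nnreal, ENNReal.ofReal_lt_ofReal_iff']
      exact ⟨fun h => h.1, fun h => ⟨h, t.2.trans_lt h⟩⟩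
    rw [h1, complexGaussian_one_tail t.coe_nonneg, ← ENNReal.ofReal_coe_nnreal, expNeg_ofReal t.coe_nonneg]

namespace Params

variable (c : Params)

instance : IsProbabilityMeasure (gammaMeasure c.κhat 1) :=
  isProbabilityMeasure_gammaMeasure (by exact_mod_cast c.κhat_pos) one_pos

instance : IsProbabilityMeasure c.markLaw := by
  unfold markLaw
  infer_instance

theorem lintegral_markLaw {f : Mark → ℝ≥0∞} (hf : Measurable f) :
    ∫⁻ m, f m ∂c.markLaw =
      ENNReal.ofReal c.p * ∫⁻ x, f (true, x) ∂((complexGaussian 1).prod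
        ((complexGaussian c.N).prod (gammaMeasure c.κhat 1))) +
      ENNReal.ofReal (1 - c.p) * ∫⁻ x, f (false, x) ∂((complexGaussian 1).prod
        ((complexGaussian c.N).prod (gammaMeasure c.κhat 1))) := by
  have h1 : ((unitInterval.toNNReal ⟨c.p, c.p_mem⟩ : ℝ≥0) : ℝ≥0∞) = ENNReal.ofReal c.p := by
    rw [← ENNReal.ofReal_coe_nnreal]; rfl
  have h2 : ((unitInterval.toNNReal (unitInterval.symm ⟨c.p, c.p_mem⟩) : ℝ≥0) : ℝ≥0∞) =
      ENNReal.ofReal (1 - c.p) := by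
    rw [← ENNReal.ofReal_coe_nnreal]; rfl
  unfold markLaw
  rw [lintegral_prod _ hf.aemeasurable, bernoulliMeasure_def, lintegral_add_measure,
    lintegral_smul_measure, lintegral_smul_measure, lintegral_dirac, lintegral_dirac, ← h1, ← h2]
  rfl

theorem etaG_pos {d : ℝ} (hd : 0 < d) : 0 < c.etaG d :=
  mul_pos c.Cd_pos (Real.rpow_pos_of_pos hd _)

theorem etaH_pos {d : ℝ} (hd : 0 < d) : 0 < c.etaH d :=
  mul_pos c.Cr_pos (Real.rpow_pos_of_pos (mul_pos c.d₀_pos hd) _)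

theorem measurableSet_mark : MeasurableSet {m : Mark | m.1 = true} :=
  measurable_fst (measurableSet_singleton true)

@[fun_prop]
theorem measurable_etaG : Measurable c.etaG := by
  unfold etaG
  fun_prop

@[fun_prop]
theorem measurable_etaH : Measurable c.etaH := by
  unfold etaH
  fun_prop

theorem measurable_interference : Measurable fun q : ℝ × Mark => c.interference q.1 q.2 := by
  unfold interference
  refine Measurable.ite (measurable_snd measurableSet_mark) ?_ ?_ <;> fun_prop

theorem measurable_signal : Measurable fun q : ℝ × Mark => c.signal q.1 q.2 := by
  unfold signal ωs
  refine Measurable.ite (measurable_snd measurableSet_mark) ?_ ?_ <;> fun_prop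

theorem interference_nonneg (d : ℝ) (m : Mark) : 0 ≤ c.interference d m := by
  unfold interference
  split_ifs <;> positivity

/-- Laplace transform of the interference of a transmitter. -/
theorem lintegral_expNeg_interference {d t : ℝ} (hd : 0 < d) (ht : 0 ≤ t) :
    ∫⁻ m, expNeg (ENNReal.ofReal (t * c.interference d m)) ∂c.markLaw =
      ENNReal.ofReal (c.p / (1 + t * (c.etaG d + c.N * c.etaH d)) +
        (1 - c.p) / (1 + t * c.etaG d)) := by
  have hG := c.etaG_pos hd
  have hH := c.etaH_pos hd
  have hp := c.p_mem
  have hq : 0 ≤ 1 - c.p := by linarith [hp.2]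
  have hmeas : Measurable fun m : Mark => ENNReal.ofReal (t * c.interference d m) :=
    ((c.measurable_interference.comp (measurable_const.prodMk measurable_id)).const_mul t).ennreal_ofReal
  rw [lintegral_markLaw _ (show Measurable fun m : Mark =>
    expNeg (ENNReal.ofReal (t * c.interference d m)) from measurable_expNeg.comp hmeas)]
  simp_rw [expNeg_ofReal (mul_nonneg ht (c.interference_nonneg d _))]
  have h1 : ∫⁻ x : ℂ × ℂ × ℝ, ENNReal.ofReal (Real.exp (-(t * c.interference d (true, x))))
      ∂((complexGaussian 1).prod ((complexGaussian c.N).prod (gammaMeasure c.κhat 1))) =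
      ENNReal.ofReal (1 / (1 + t * (c.etaG d + c.N * c.etaH d))) := by
    simp only [interference, if_true]
    rw [lintegral_prod _ (by fun_prop)]
    have h2 := lintegral_exp_neg_norm_sq_complexGaussian 1 c.N √(c.etaG d) √(c.etaH d) ht
    rw [Real.sq_sqrt hG.le, Real.sq_sqrt hH.le] at h2
    rw [show c.etaG d + c.N * c.etaH d = c.etaG d * (1 : ℝ≥0) + c.etaH d * (c.N : ℝ≥0) by
      push_cast; ring, ← h2]
    refine lintegral_congr fun z => ?_
    rw [lintegral_prod _ (by fun_prop)]
    simp
  have h3 : ∫⁻ x : ℂ × ℂ × ℝ, ENNReal.ofReal (Real.exp (-(t * c.interference d (false, x))))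
      ∂((complexGaussian 1).prod ((complexGaussian c.N).prod (gammaMeasure c.κhat 1))) =
      ENNReal.ofReal (1 / (1 + t * c.etaG d)) := by
    simp only [interference, Bool.false_eq_true, if_false]
    rw [lintegral_prod _ (by fun_prop)]
    -- Without a RIS the second Gaussian is a dummy with coefficient `0`.
    have h2 := lintegral_exp_neg_norm_sq_complexGaussian 1 1 √(c.etaG d) 0 ht
    rw [Real.sq_sqrt hG.le] at h2
    rw [show c.etaG d = c.etaG d * (1 : ℝ≥0) + 0 ^ 2 * (1 : ℝ≥0) by push_cast; ring, ← h2]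
    refine lintegral_congr fun z => ?_
    simp
  rw [h1, h3, ← ENNReal.ofReal_mul hp.1, ← ENNReal.ofReal_mul hq, ← ENNReal.ofReal_add]
  · congr 1
    ring
  · have := hp.1
    positivity
  · positivity

theorem ofReal_mul_lt_ofReal_iff {g e x : ℝ} (hg : 0 < g) (he : 0 < e) (D : ℝ≥0∞) :
    ENNReal.ofReal g * D < ENNReal.ofReal (e * x) ↔
      ENNReal.ofReal (g / e) * D < ENNReal.ofReal x := by
  have he' : ENNReal.ofReal e ≠ 0 := by simpa using he
  rw [ENNReal.ofReal_mul he.le, show g = e * (g / e) by field_simp, ENNReal.ofReal_mul he.le,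
    mul_assoc, ENNReal.mul_lt_mul_iff_right he' ENNReal.ofReal_ne_top]
  congr! 3
  field_simp

/-- Conditional coverage probability, given the interference and noise power `D`. -/
theorem markLaw_signal {d γ : ℝ} (hd : 0 < d) (hγ : 0 < γ) {D : ℝ≥0∞} (hD : D ≠ 0) :
    c.markLaw {m | ENNReal.ofReal γ < ENNReal.ofReal (c.signal d m) / D} =
      ENNReal.ofReal c.p * gammaTail c.κhat (ENNReal.ofReal (γ / c.χbar / c.etaG d) * D) +
      ENNReal.ofReal (1 - c.p) * expNeg (ENNReal.ofReal (γ / c.etaG d) * D) := by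
  have hG := c.etaG_pos hd
  have hχ := c.χbar_pos
  have hsig : Measurable fun m : Mark => c.signal d m :=
    c.measurable_signal.comp (measurable_const.prodMk measurable_id)
  have hset : {m | ENNReal.ofReal γ < ENNReal.ofReal (c.signal d m) / D} =
      {m | ENNReal.ofReal γ * D < ENNReal.ofReal (c.signal d m)} := by
    ext m
    exact ENNReal.lt_div_iff_mul_lt (.inl hD) (.inr (by simpa using hγ))
  have hmeas : MeasurableSet {m | ENNReal.ofReal γ * D < ENNReal.ofReal (c.signal d m)} :=
    measurableSet_lt measurable_const hsig.ennreal_ofReal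
  rw [hset, ← lintegral_indicator_one hmeas, lintegral_markLaw _ (measurable_one.indicator hmeas)]
  congr 2
  · have h1 : ∀ x : ℂ × ℂ × ℝ, {m | ENNReal.ofReal γ * D < ENNReal.ofReal (c.signal d m)}.indicator
        (1 : Mark → ℝ≥0∞) (true, x) =
        {y | ENNReal.ofReal (γ / c.χbar / c.etaG d) * D < ENNReal.ofReal y}.indicator 1 x.2.2 := by
      intro x
      simp only [indicator, mem_ofPred_eq, Pi.one_apply, signal, if_true, ωs,
        ofReal_mul_lt_ofReal_iff hγ (mul_pos hG hχ), div_div, mul_comm c.χbar]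
    have hm : MeasurableSet {y | ENNReal.ofReal (γ / c.χbar / c.etaG d) * D < ENNReal.ofReal y} :=
      measurableSet_lt measurable_const (by fun_prop)
    simp_rw [h1]
    refine ((measurePreserving_snd.comp measurePreserving_snd).lintegral_comp
      (measurable_one.indicator hm)).trans ?_
    rw [lintegral_indicator_one hm, gammaMeasure_lt_ofReal c.κhat_pos]
  · have h1 : ∀ x : ℂ × ℂ × ℝ, {m | ENNReal.ofReal γ * D < ENNReal.ofReal (c.signal d m)}.indicator
        (1 : Mark → ℝ≥0∞) (false, x) =
        {z : ℂ | ENNReal.ofReal (γ / c.etaG d) * D < ENNReal.ofReal (‖z‖ ^ 2)}.indicator 1 x.1 := by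
      intro x
      simp only [indicator, mem_ofPred_eq, Pi.one_apply, signal, Bool.false_eq_true, if_false,
        ofReal_mul_lt_ofReal_iff hγ hG]
    have hm : MeasurableSet {z : ℂ | ENNReal.ofReal (γ / c.etaG d) * D < ENNReal.ofReal (‖z‖ ^ 2)} :=
      measurableSet_lt measurable_const (by fun_prop)
    simp_rw [h1]
    refine (measurePreserving_fst.lintegral_comp (measurable_one.indicator hm)).trans ?_
    rw [lintegral_indicator_one hm, complexGaussian_one_lt_ofReal]

/-! ### The network as a product measure -/

/-- Index of the point of a configuration that is nearest to the origin. -/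
def nearestIdx (φ : ℕ → Plane) : ℕ := nearest (fun k (φ : ℕ → Plane) => φ k) φ

/-- Distance from the origin to the nearest point of a configuration. -/
def nearestDist (φ : ℕ → Plane) : ℝ := ‖φ (nearestIdx φ)‖

/-- Interference plus inverse transmit signal-to-noise ratio. -/
def noisyInterference (q : (ℕ → Plane) × (ℕ → Mark)) : ℝ≥0∞ :=
  (∑' k, if k = nearestIdx q.1 then 0 else ENNReal.ofReal (c.interference ‖q.1 k‖ (q.2 k))) +
    ENNReal.ofReal c.γt⁻¹

@[fun_prop]
theorem measurable_nearestIdx : Measurable nearestIdx := by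
  have hS : ∀ k, MeasurableSet {φ : ℕ → Plane | ∀ j, ‖φ k‖ ≤ ‖φ j‖} := fun k => by
    simp only [ofPred_forall]
    exact MeasurableSet.iInter fun j => measurableSet_le (by fun_prop) (by fun_prop)
  refine measurable_to_countable' fun k => ?_
  -- The second piece covers configurations without a nearest point, where `sInf ∅ = 0`.
  have : nearestIdx ⁻¹' {k} =
      ({φ : ℕ → Plane | ∀ j, ‖φ k‖ ≤ ‖φ j‖} ∩ ⋂ i, ⋂ (_ : i < k), {φ : ℕ → Plane | ∀ j, ‖φ i‖ ≤ ‖φ j‖}ᶜ) ∪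
        ({_φ | k = 0} ∩ ⋂ i, {φ : ℕ → Plane | ∀ j, ‖φ i‖ ≤ ‖φ j‖}ᶜ) := by
    ext φ
    simp only [mem_preimage, mem_singleton_iff, nearestIdx, nearest, mem_union, mem_inter_iff,
      mem_ofPred_eq, mem_iInter, mem_compl_iff]
    by_cases hne : {k | ∀ j, ‖φ k‖ ≤ ‖φ j‖}.Nonempty
    · constructor
      · rintro rfl
        exact .inl ⟨Nat.sInf_mem hne, fun i hi => Nat.notMem_of_lt_sInf hi⟩
      · rintro (⟨h1, h2⟩ | ⟨-, h2⟩)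
        · refine le_antisymm (Nat.sInf_le h1) (not_lt.1 fun hlt => h2 _ hlt (Nat.sInf_mem hne))
        · obtain ⟨i, hi⟩ := hne
          exact absurd hi (h2 i)
    · rw [not_nonempty_iff_eq_empty] at hne
      have hall : ∀ i, ¬ ∀ j, ‖φ i‖ ≤ ‖φ j‖ := fun i hi => by
        have : i ∈ {k | ∀ j, ‖φ k‖ ≤ ‖φ j‖} := hi
        rw [hne] at this
        exact this
      rw [hne, Nat.sInf_empty]
      constructor
      · rintro rfl
        exact .inr ⟨rfl, hall⟩
      · rintro (⟨h1, -⟩ | ⟨h1, -⟩)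
        · exact absurd h1 (hall k)
        · exact h1.symm
  rw [this]
  refine ((hS k).inter (MeasurableSet.iInter fun i => MeasurableSet.iInter fun _ => (hS i).compl)).union
    (MeasurableSet.inter (MeasurableSet.const _) (MeasurableSet.iInter fun i => (hS i).compl))

theorem measurable_eval_nearestIdx {E F : Type*} [MeasurableSpace E] [MeasurableSpace F]
    {g : F → ℕ} (hg : Measurable g) {h : F → ℕ → E} (hh : Measurable h) :
    Measurable fun x => h x (g x) := by
  have h1 : Measurable fun p : ℕ × F => h p.2 p.1 :=
    measurable_from_prod_countable_right fun k => (measurable_pi_apply k).comp hh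
  exact h1.comp (hg.prodMk measurable_id)

@[fun_prop]
theorem measurable_nearestDist : Measurable nearestDist :=
  (measurable_eval_nearestIdx measurable_nearestIdx measurable_id).norm

theorem measurable_noisyInterference : Measurable c.noisyInterference := by
  unfold noisyInterference
  refine Measurable.add (Measurable.tsum fun k => Measurable.ite ?_ measurable_const ?_)
    measurable_const
  · exact measurableSet_eq_fun measurable_const (by fun_prop)
  · exact (c.measurable_interference.comp (f := fun q : (ℕ → Plane) × (ℕ → Mark) =>
      (‖q.1 k‖, q.2 k)) (by fun_prop)).ennreal_ofReal

theorem measurableSet_coverage (γ : ℝ) : MeasurableSet {q : (ℕ → Plane) × (ℕ → Mark) |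
    ENNReal.ofReal γ < ENNReal.ofReal (c.signal (nearestDist q.1) (q.2 (nearestIdx q.1))) /
      c.noisyInterference q} := by
  refine measurableSet_lt measurable_const (Measurable.div ?_ c.measurable_noisyInterference)
  refine (c.measurable_signal.comp (f := fun q : (ℕ → Plane) × (ℕ → Mark) =>
    (nearestDist q.1, q.2 (nearestIdx q.1))) (Measurable.prodMk (by fun_prop) ?_)).ennreal_ofReal
  exact measurable_eval_nearestIdx (measurable_nearestIdx.comp measurable_fst) measurable_snd

section Network

variable {c} {Ω : Type*} [MeasurableSpace Ω] {Pr : Measure Ω}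
  {Φ : ℕ → Ω → Plane} {M : ℕ → Ω → Mark}

theorem IsNetwork.measurable_points (h : c.IsNetwork Φ M Pr) : Measurable fun ω k => Φ k ω :=
  measurable_pi_iff.2 h.poisson.measurable

theorem IsNetwork.hasLaw [IsProbabilityMeasure Pr] (h : c.IsNetwork Φ M Pr) :
    HasLaw (fun ω => ((fun k => Φ k ω, fun k => M k ω) : (ℕ → Plane) × (ℕ → Mark)))
      ((Pr.map fun ω k => Φ k ω).prod (Measure.infinitePi fun _ => c.markLaw)) Pr where
  aemeasurable := h.measurable_points.aemeasurable.prodMk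
    (aemeasurable_pi_iff.2 fun k => (h.hasLaw_mark k).aemeasurable)
  map_eq := by
    have hM : AEMeasurable (fun ω k => M k ω) Pr :=
      aemeasurable_pi_iff.2 fun k => (h.hasLaw_mark k).aemeasurable
    rw [h.indepFun.map_prod_eq_prod_map_map h.measurable_points.aemeasurable hM,
      (h.iIndepFun_mark.hasLaw_infinitePi h.hasLaw_mark hM).map_eq]

/-- The preimage of `(-∞, b)`, for `b > 0`, is a disc of area `b / λ_t`; the normalisation `π λ_t`
makes the rate one. Finite values on these half-lines determine the measure. -/
theorem map_norm_sq_volume (c : Params) :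
    (ENNReal.ofReal c.lam • volume : Measure Plane).map (fun x => Real.pi * c.lam * ‖x‖ ^ 2) =
      volume.restrict (Ici (0 : ℝ)) := by
  have hL : 0 < Real.pi * c.lam := mul_pos Real.pi_pos c.lam_pos
  have hmeas : Measurable fun x : Plane => Real.pi * c.lam * ‖x‖ ^ 2 := by fun_prop
  have h1 : ∀ b : ℝ, (ENNReal.ofReal c.lam • volume : Measure Plane).map
      (fun x => Real.pi * c.lam * ‖x‖ ^ 2) (Iio b) = ENNReal.ofReal b := by
    intro b
    rw [Measure.map_apply hmeas measurableSet_Iio]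
    rcases le_or_gt b 0 with hb | hb
    · have : (fun x : Plane => Real.pi * c.lam * ‖x‖ ^ 2) ⁻¹' Iio b = ∅ := by
        refine eq_empty_of_forall_notMem fun x hx => ?_
        have hx : Real.pi * c.lam * ‖x‖ ^ 2 < b := hx
        have : 0 ≤ Real.pi * c.lam * ‖x‖ ^ 2 := by positivity
        linarith
      rw [this, measure_empty, ENNReal.ofReal_of_nonpos hb]
    · have : (fun x : Plane => Real.pi * c.lam * ‖x‖ ^ 2) ⁻¹' Iio b =
          Metric.ball 0 √(b / (Real.pi * c.lam)) := by
        ext x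
        rw [mem_ball_zero_iff, Real.lt_sqrt (norm_nonneg x), lt_div_iff₀ hL, mul_comm (‖x‖ ^ 2)]
        rfl
      rw [this, Measure.smul_apply, EuclideanSpace.volume_ball_fin_two, smul_eq_mul,
        ← ENNReal.ofReal_pow (Real.sqrt_nonneg _), Real.sq_sqrt (by positivity),
        ← ENNReal.ofReal_mul (by positivity), ← ENNReal.ofReal_mul c.lam_pos.le]
      congr 1
      have := c.lam_pos
      have := Real.pi_pos
      field_simp
  have h2 : ∀ b : ℝ, (volume.restrict (Ici (0 : ℝ))) (Iio b) = ENNReal.ofReal b := by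
    intro b
    rw [Measure.restrict_apply measurableSet_Iio, inter_comm, Ici_inter_Iio, Real.volume_Ico, sub_zero]
  have h3 : ∀ (m : Measure ℝ), (∀ b, m (Iio b) = ENNReal.ofReal b) → ∀ a b,
      m (Ico a b) = ENNReal.ofReal b - ENNReal.ofReal a := by
    intro m hm a b
    rcases le_or_gt b a with hba | hab
    · rw [Ico_eq_empty hba.not_gt, measure_empty, tsub_eq_zero_of_le (ENNReal.ofReal_le_ofReal hba)]
    · have : Ico a b = Iio b \ Iio a := by
        ext x
        simp
      rw [this, measure_sdiff (Iio_subset_Iio hab.le) measurableSet_Iio.nullMeasurableSet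
        (by rw [hm]; exact ENNReal.ofReal_ne_top), hm, hm]
  refine Measure.ext_of_Ico' _ _ (fun a b _ => ?_) (fun a b _ => ?_)
  · rw [h3 _ h1]
    exact ENNReal.sub_ne_top ENNReal.ofReal_ne_top
  · rw [h3 _ h1, h3 _ h2]

theorem IsNetwork.isPoissonProcess_norm_sq (h : c.IsNetwork Φ M Pr) :
    IsPoissonProcess (volume.restrict (Ici (0 : ℝ)))
      (fun k ω => Real.pi * c.lam * ‖Φ k ω‖ ^ 2) Pr := by
  rw [← map_norm_sq_volume]
  exact h.poisson.map (g := fun x => Real.pi * c.lam * ‖x‖ ^ 2) (by fun_prop)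

/-- Almost surely there is a nearest transmitter, and it is not at the origin. -/
theorem IsNetwork.ae_nearest [IsProbabilityMeasure Pr] (h : c.IsNetwork Φ M Pr) :
    ∀ᵐ ω ∂Pr, 0 < nearestDist (fun k => Φ k ω) ∧
      ∀ k, nearestDist (fun k => Φ k ω) ≤ ‖Φ k ω‖ := by
  have hL : 0 < Real.pi * c.lam := mul_pos Real.pi_pos c.lam_pos
  have hU := h.isPoissonProcess_norm_sq
  -- The count of the null set `{0}` is Poisson of mean `0`.
  have hzero : ∀ᵐ ω ∂Pr, ∀ k, Φ k ω ≠ 0 := by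
    have hvol : (volume.restrict (Ici (0 : ℝ))) {0} = 0 :=
      measure_mono_null (subset_refl _) (by simp)
    have hlaw := hU.hasLaw_count {0} (measurableSet_singleton 0) (by rw [hvol]; exact ENNReal.zero_lt_top)
    rw [hvol, ENNReal.toNNReal_zero] at hlaw
    have hint := HasLaw_lintegral_count hlaw (fun m => if m = 0 then 0 else 1)
    have h0 : ∫⁻ m : ℕ, (if (m : ℕ∞) = 0 then (0 : ℝ≥0∞) else 1) ∂poissonMeasure 0 = 0 := by
      rw [lintegral_poissonMeasure, ENNReal.tsum_eq_zero]
      intro m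
      rcases Nat.eq_zero_or_pos m with rfl | hm
      · simp
      · simp [hm.ne']
    have hae := (lintegral_eq_zero_iff' ((Measurable.of_discrete
      (f := fun m : ℕ∞ => if m = 0 then (0 : ℝ≥0∞) else 1)).comp_aemeasurable
      hlaw.aemeasurable)).1 (hint.trans h0)
    filter_upwards [hae] with ω hω k hk
    have h1 : count (fun k ω => Real.pi * c.lam * ‖Φ k ω‖ ^ 2) {0} ω = 0 := by
      by_contra hc
      simp [hc] at hω
    unfold count at h1
    rw [encard_eq_zero] at h1
    have h2 : k ∈ {k | Real.pi * c.lam * ‖Φ k ω‖ ^ 2 ∈ ({0} : Set ℝ)} := by simp [hk]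
    rw [h1] at h2
    exact h2
  filter_upwards [hzero, ae_exists_isolated hU] with ω h0 hiso
  obtain ⟨n, k, hk⟩ := hiso
  have hmem : k ∈ {k | ∀ j, ‖Φ k ω‖ ≤ ‖Φ j ω‖} := by
    intro j
    rcases eq_or_ne j k with rfl | hne
    · exact le_rfl
    · have h1 : Real.pi * c.lam * ‖Φ k ω‖ ^ 2 < Real.pi * c.lam * ‖Φ j ω‖ ^ 2 := hk.lt hne
      rw [mul_lt_mul_iff_right₀ hL] at h1
      exact (lt_of_pow_lt_pow_left₀ 2 (norm_nonneg _) h1).le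
  have hst : nearestIdx (fun k => Φ k ω) ∈ {k | ∀ j, ‖Φ k ω‖ ≤ ‖Φ j ω‖} := Nat.sInf_mem ⟨k, hmem⟩
  exact ⟨norm_pos_iff.2 (h0 _), hst⟩

end Network

/-! ### Laplace transform of the interference -/

section Ratio

variable {p y₁ y₂ : ℝ}

/-- Laplace transform of the interference of a transmitter, as a function of the squared ratio of
the distances of the nearest transmitter and of this transmitter. -/
def ratioLaplace (p y₁ y₂ t : ℝ) : ℝ := p / (1 + y₁ * t ^ 2) + (1 - p) / (1 + y₂ * t ^ 2)

theorem continuous_ratioLaplace (h₁ : 0 < y₁) (h₂ : 0 < y₂) : Continuous (ratioLaplace p y₁ y₂) := by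
  unfold ratioLaplace
  refine (continuous_const.div (by fun_prop) fun t => ?_).add
    (continuous_const.div (by fun_prop) fun t => ?_) <;> positivity

theorem antitoneOn_ratioLaplace (hp : p ∈ Icc (0 : ℝ) 1) (h₁ : 0 < y₁) (h₂ : 0 < y₂) :
    AntitoneOn (ratioLaplace p y₁ y₂) (Ici 0) := by
  intro s hs t ht hst
  have hs : 0 ≤ s := hs
  have hp0 := hp.1
  have hp1 : 0 ≤ 1 - p := by linarith [hp.2]
  unfold ratioLaplace
  gcongr

theorem ratioLaplace_pos (hp : p ∈ Icc (0 : ℝ) 1) (h₁ : 0 < y₁) (h₂ : 0 < y₂) (t : ℝ) :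
    0 < ratioLaplace p y₁ y₂ t := by
  have hp1 : 0 ≤ 1 - p := by linarith [hp.2]
  unfold ratioLaplace
  rcases hp.1.eq_or_lt with h | h
  · rw [← h]
    have : (0 : ℝ) < 1 - 0 := by norm_num
    positivity
  · positivity

theorem one_sub_ratioLaplace (h₁ : 0 < y₁) (h₂ : 0 < y₂) {t : ℝ} (ht : 0 < t) :
    1 - ratioLaplace p y₁ y₂ t = p * (y₁ / (t⁻¹ ^ 2 + y₁)) + (1 - p) * (y₂ / (t⁻¹ ^ 2 + y₂)) := by
  unfold ratioLaplace
  field_simp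
  ring

theorem ratioLaplace_le_one (hp : p ∈ Icc (0 : ℝ) 1) (h₁ : 0 < y₁) (h₂ : 0 < y₂) (t : ℝ) :
    ratioLaplace p y₁ y₂ t ≤ 1 := by
  have hp0 := hp.1
  have hp1 : 0 ≤ 1 - p := by linarith [hp.2]
  unfold ratioLaplace
  have e1 : p / (1 + y₁ * t ^ 2) ≤ p := div_le_self hp0 (by nlinarith [sq_nonneg t])
  have e2 : (1 - p) / (1 + y₂ * t ^ 2) ≤ 1 - p := div_le_self hp1 (by nlinarith [sq_nonneg t])
  linarith

/-- The integrand depends on `x / u` only, so rescaling pulls out a factor `u`. This linearity keeps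
the final exponent quadratic in `u`. -/
theorem lintegral_one_sub_ratioLaplace (hp : p ∈ Icc (0 : ℝ) 1) (h₁ : 0 < y₁) (h₂ : 0 < y₂) {u : ℝ}
    (hu : 0 < u) :
    ∫⁻ x in Ioi u, ENNReal.ofReal (1 - ratioLaplace p y₁ y₂ (u / x)) =
      ENNReal.ofReal (u * (p * (√y₁ * Real.arctan √y₁) + (1 - p) * (√y₂ * Real.arctan √y₂))) := by
  obtain ⟨i1, e1⟩ := integral_Ioi_one_div h₁
  obtain ⟨i2, e2⟩ := integral_Ioi_one_div h₂
  have hg : IntegrableOn (fun x : ℝ => p * (y₁ / (x ^ 2 + y₁)) + (1 - p) * (y₂ / (x ^ 2 + y₂)))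
    (Ioi 1) := (i1.const_mul p).add (i2.const_mul (1 - p))
  have hcomp : ∀ x ∈ Ioi u, 1 - ratioLaplace p y₁ y₂ (u / x) =
      p * (y₁ / ((u⁻¹ * x) ^ 2 + y₁)) + (1 - p) * (y₂ / ((u⁻¹ * x) ^ 2 + y₂)) := by
    intro x hx
    have hx : 0 < x := hu.trans hx
    rw [one_sub_ratioLaplace h₁ h₂ (div_pos hu hx), inv_div, div_eq_inv_mul x u]
  have hone : u⁻¹ * u = 1 := inv_mul_cancel₀ hu.ne'
  rw [setLIntegral_congr_fun measurableSet_Ioi (fun x hx => by rw [hcomp x hx]),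
    ← ofReal_integral_eq_lintegral_ofReal]
  · rw [integral_comp_mul_left_Ioi (fun x : ℝ => p * (y₁ / (x ^ 2 + y₁)) + (1 - p) *
      (y₂ / (x ^ 2 + y₂))) u (inv_pos.2 hu), hone, integral_add (i1.const_mul p) (i2.const_mul _),
      integral_const_mul, integral_const_mul, e1, e2, inv_inv, smul_eq_mul]
  · have := (integrableOn_Ioi_comp_mul_left_iff (fun x : ℝ => p * (y₁ / (x ^ 2 + y₁)) + (1 - p) *
      (y₂ / (x ^ 2 + y₂))) u (inv_pos.2 hu)).2 (by rw [hone]; exact hg)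
    exact this
  · filter_upwards [ae_restrict_mem measurableSet_Ioi] with x hx
    rw [Pi.zero_apply, ← hcomp x hx]
    linarith [ratioLaplace_le_one hp h₁ h₂ (u / x)]

end Ratio

theorem lintegral_exp_quadratic {x y L : ℝ} (hx : 0 < x) (hy : 0 < y) (hL : 0 < L) :
    ∫⁻ u in Ioi (0 : ℝ), ENNReal.ofReal (Real.exp (-(x * (L⁻¹ * u) ^ 2 + y * (L⁻¹ * u)))) =
      ENNReal.ofReal (L / 2 * erfcTerm x y) := by
  have hi : IntegrableOn (fun t : ℝ => Real.exp (-(x * t ^ 2 + y * t))) (Ioi 0) := by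
    refine Integrable.mono' (integrableOn_exp_mul_Ioi (neg_lt_zero.2 hy) 0) (by fun_prop) ?_
    refine ae_of_all _ fun t => ?_
    rw [Real.norm_of_nonneg (Real.exp_pos _).le]
    gcongr
    nlinarith [sq_nonneg t]
  rw [← ofReal_integral_eq_lintegral_ofReal]
  · rw [integral_comp_mul_left_Ioi (fun t : ℝ => Real.exp (-(x * t ^ 2 + y * t))) 0 (inv_pos.2 hL),
      mul_zero, integral_Ioi_exp_quadratic hx, inv_inv, smul_eq_mul]
    congr 1
    ring
  · have := (integrableOn_Ioi_comp_mul_left_iff (fun t : ℝ => Real.exp (-(x * t ^ 2 + y * t))) 0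
      (inv_pos.2 hL)).2 (by rw [mul_zero]; exact hi)
    exact this
  · exact ae_of_all _ fun _ => (Real.exp_pos _).le

theorem etaG_eq (hα : c.α = 4) {d : ℝ} (hd : 0 < d) : c.etaG d = c.Cd / d ^ 4 := by
  unfold etaG
  rw [hα, Real.rpow_neg hd.le]
  norm_cast

theorem etaG_add_etaH (hα : c.α = 4) {d : ℝ} (hd : 0 < d) :
    c.etaG d + c.N * c.etaH d = c.e₁ / d ^ 4 := by
  unfold etaG etaH e₁
  rw [hα, Real.mul_rpow c.d₀_pos.le hd.le, Real.rpow_neg hd.le]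
  have : d ^ (4 : ℝ) = d ^ 4 := by norm_cast
  rw [this]
  field_simp

theorem measurable_mul_noisyInterference (b : ℝ) : Measurable fun q : (ℕ → Plane) × (ℕ → Mark) =>
    ENNReal.ofReal (b / c.etaG (nearestDist q.1)) * c.noisyInterference q :=
  Measurable.mul (by fun_prop) c.measurable_noisyInterference

theorem measurable_expNeg_mul_noisyInterference (b : ℝ) :
    Measurable fun q : (ℕ → Plane) × (ℕ → Mark) =>
      expNeg (ENNReal.ofReal (b / c.etaG (nearestDist q.1)) * c.noisyInterference q) :=
  measurable_expNeg.comp (c.measurable_mul_noisyInterference b)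

/-- `b` times the noisy interference divided by the path gain of the nearest transmitter: Laplace
transform over the marks. -/
theorem lintegral_marks_noisyInterference (hα : c.α = 4) {b : ℝ} (hb : 0 < b) {φ : ℕ → Plane}
    (h0 : 0 < nearestDist φ) (hφ : ∀ k, nearestDist φ ≤ ‖φ k‖) :
    ∫⁻ m, expNeg (ENNReal.ofReal (b / c.etaG (nearestDist φ)) * c.noisyInterference (φ, m))
        ∂Measure.infinitePi (fun _ : ℕ => c.markLaw) =
      ENNReal.ofReal (Real.exp (-(b * c.γt⁻¹ / c.Cd *
        ((Real.pi * c.lam)⁻¹ * (Real.pi * c.lam * nearestDist φ ^ 2)) ^ 2))) *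
      expNeg (∑' k, if k = nearestIdx φ then 0 else ENNReal.ofReal (-Real.log
        (ratioLaplace c.p (b * c.e₁ / c.Cd) b
          (Real.pi * c.lam * nearestDist φ ^ 2 / (Real.pi * c.lam * ‖φ k‖ ^ 2))))) := by
  set r := nearestDist φ with hr
  have hL : 0 < Real.pi * c.lam := mul_pos Real.pi_pos c.lam_pos
  have hlam := c.lam_pos
  have hG := c.etaG_pos h0
  have hCd := c.Cd_pos
  have he := c.e₁_pos
  have hγt := c.γt_pos
  have hbG : 0 ≤ b / c.etaG r := by positivity
  have h1 : ∀ m : ℕ → Mark, expNeg (ENNReal.ofReal (b / c.etaG r) * c.noisyInterference (φ, m)) =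
      expNeg (∑' k, (if k = nearestIdx φ then 0 else
        ENNReal.ofReal (b / c.etaG r * c.interference ‖φ k‖ (m k)))) *
      expNeg (ENNReal.ofReal (b / c.etaG r * c.γt⁻¹)) := by
    intro m
    rw [noisyInterference, mul_add, expNeg_add, ← ENNReal.tsum_mul_left, ← ENNReal.ofReal_mul hbG]
    simp_rw [mul_ite, mul_zero, ← ENNReal.ofReal_mul hbG]
  have ha : ∀ k, Measurable fun m : Mark => if k = nearestIdx φ then (0 : ℝ≥0∞) else
        ENNReal.ofReal (b / c.etaG r * c.interference ‖φ k‖ m) := by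
    intro k
    split_ifs
    · exact measurable_const
    · exact ((c.measurable_interference.comp
        (measurable_const.prodMk measurable_id)).const_mul _).ennreal_ofReal
  have hy : 0 < b * c.e₁ / c.Cd := by positivity
  have hR : Measurable fun m : ℕ → Mark => expNeg (∑' k, if k = nearestIdx φ then 0 else
      ENNReal.ofReal (b / c.etaG r * c.interference ‖φ k‖ (m k))) :=
    measurable_expNeg.comp (Measurable.tsum fun k => (ha k).comp (measurable_pi_apply k))
  simp_rw [h1]
  rw [lintegral_mul_const _ hR, mul_comm,
    expNeg_ofReal (by positivity)]
  congr 1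
  -- The noise exponent is `b γ_t⁻¹ r⁴ / C_d`; it is written through `π λ_t r²` so as to be a
  -- function of the nearest point of the half-line process.
  · rw [c.etaG_eq hα h0]
    congr 3
    field_simp
  · refine lintegral_infinitePi_expNeg_tsum ha fun k => ?_
    split_ifs
    · simp
    · have hd : 0 < ‖φ k‖ := h0.trans_le (hφ k)
      rw [c.lintegral_expNeg_interference hd hbG, expNeg_ofReal_neg_log
        (ratioLaplace_pos c.p_mem hy hb _) (ratioLaplace_le_one c.p_mem hy hb _),
        c.etaG_add_etaH hα hd, c.etaG_eq hα hd, c.etaG_eq hα h0, ratioLaplace]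
      congr 3
      · field_simp
      · field_simp

/-- Marks are averaged out first, then the locations through `lintegral_nearest`. With `t = u / L`
the total exponent is `-(x t² + L (1 + J) t)`, and since `p + (1 - p) = 1` the constant `1` in `1 +
J` is absorbed into the two hypergeometric values. -/
theorem IsNetwork.lintegral_noisyInterference {Ω : Type*} [MeasurableSpace Ω] {Pr : Measure Ω}
    [IsProbabilityMeasure Pr] {Φ : ℕ → Ω → Plane} {M : ℕ → Ω → Mark} {c : Params}
    (h : c.IsNetwork Φ M Pr) (hα : c.α = 4) {b : ℝ} (hb : 0 < b) :
    ∫⁻ q, expNeg (ENNReal.ofReal (b / c.etaG (nearestDist q.1)) * c.noisyInterference q)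
        ∂(Pr.map fun ω k => Φ k ω).prod (Measure.infinitePi fun _ => c.markLaw) =
      ENNReal.ofReal (Real.pi * c.lam / 2 * erfcTerm (b * c.γt⁻¹ / c.Cd)
        (Real.pi * c.lam * c.p * hyp2F1 1 (-1 / 2) (1 / 2) (-(b * c.e₁ / c.Cd)) +
          Real.pi * c.lam * (1 - c.p) * hyp2F1 1 (-1 / 2) (1 / 2) (-b))) := by
  have hL : 0 < Real.pi * c.lam := mul_pos Real.pi_pos c.lam_pos
  have hCd := c.Cd_pos
  have he := c.e₁_pos
  have hγt := c.γt_pos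
  have hp0 := c.p_mem.1
  have hp1 : 0 ≤ 1 - c.p := by linarith [c.p_mem.2]
  have hy : 0 < b * c.e₁ / c.Cd := by positivity
  have hx : 0 < b * c.γt⁻¹ / c.Cd := by positivity
  set x := b * c.γt⁻¹ / c.Cd with hx_def
  set y := b * c.e₁ / c.Cd with hy_def
  set L := Real.pi * c.lam with hL_def
  set J := c.p * (√y * Real.arctan √y) + (1 - c.p) * (√b * Real.arctan √b) with hJ
  have hJ0 : 0 ≤ J := by
    have a1 : 0 ≤ Real.arctan √y := Real.arctan_nonneg.2 (Real.sqrt_nonneg _)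
    have a2 : 0 ≤ Real.arctan √b := Real.arctan_nonneg.2 (Real.sqrt_nonneg _)
    positivity
  have hmeas := c.measurable_expNeg_mul_noisyInterference b
  have hstar : ∀ᵐ ω ∂Pr, ∀ k, L * ‖Φ (nearestIdx fun k => Φ k ω) ω‖ ^ 2 ≤ L * ‖Φ k ω‖ ^ 2 := by
    filter_upwards [h.ae_nearest] with ω hω k
    have := hω.2 k
    unfold nearestDist at this
    gcongr
  rw [lintegral_prod _ hmeas.aemeasurable,
    lintegral_map (Measurable.lintegral_prod_right' hmeas) h.measurable_points]
  refine (lintegral_congr_ae (h.ae_nearest.mono fun ω hω =>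
    c.lintegral_marks_noisyInterference hα hb hω.1 hω.2)).trans ?_
  have hmain := lintegral_nearest h.isPoissonProcess_norm_sq (fun k ω => by positivity) hstar
    (continuous_ratioLaplace (p := c.p) hy hb) (antitoneOn_ratioLaplace c.p_mem hy hb)
    (ratioLaplace_pos c.p_mem hy hb) (ratioLaplace_le_one c.p_mem hy hb)
    (w := fun u => ENNReal.ofReal (Real.exp (-(x * (L⁻¹ * u) ^ 2))))
    (ENNReal.continuous_ofReal.comp (by fun_prop)) (fun u => by
      rw [← ENNReal.ofReal_one]
      refine ENNReal.ofReal_le_ofReal (Real.exp_le_one_iff.2 ?_)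
      have : 0 ≤ x * (L⁻¹ * u) ^ 2 := by positivity
      linarith)
  refine hmain.trans ?_
  rw [hyp2F1_neg hy, hyp2F1_neg hb, ← lintegral_exp_quadratic hx (y := L * c.p *
    (1 + √y * Real.arctan √y) + L * (1 - c.p) * (1 + √b * Real.arctan √b)) ?_ hL]
  · refine setLIntegral_congr_fun measurableSet_Ioi fun u hu => ?_
    have hu : 0 < u := hu
    rw [lintegral_one_sub_ratioLaplace c.p_mem hy hb hu, ← hJ, expNeg_ofReal (by positivity),
      ← ENNReal.ofReal_mul (by positivity), ← ENNReal.ofReal_mul (by positivity), ← Real.exp_add,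
      ← Real.exp_add]
    congr 2
    rw [hJ]
    field_simp
    ring
  · have : L * c.p * (1 + √y * Real.arctan √y) + L * (1 - c.p) * (1 + √b * Real.arctan √b) =
        L * (1 + J) := by rw [hJ]; ring
    rw [this]
    positivity

/-! ### The coverage probability -/

/-- Coverage probability, conditionally on the locations `φ` and on the interference. -/
def condCoverage (γ : ℝ) (q : (ℕ → Plane) × (ℕ → Mark)) : ℝ≥0∞ :=
  ENNReal.ofReal c.p * gammaTail c.κhat
      (ENNReal.ofReal (γ / c.χbar / c.etaG (nearestDist q.1)) * c.noisyInterference q) +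
    ENNReal.ofReal (1 - c.p) *
      expNeg (ENNReal.ofReal (γ / c.etaG (nearestDist q.1)) * c.noisyInterference q)

theorem measurable_condCoverage (γ : ℝ) : Measurable (c.condCoverage γ) := by
  unfold condCoverage gammaTail
  have h1 := c.measurable_mul_noisyInterference (γ / c.χbar)
  refine Measurable.add (Measurable.const_mul (Finset.measurable_sum _ fun i _ => ?_) _)
    ((c.measurable_expNeg_mul_noisyInterference γ).const_mul _)
  exact ((h1.pow_const i).mul (measurable_expNeg.comp h1)).const_mul _

/-- For fixed locations the serving index is deterministic, so the serving mark can be integrated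
out with the interference held fixed. -/
theorem infinitePi_markLaw_coverage {γ : ℝ} (hγ : 0 < γ) {φ : ℕ → Plane} (h0 : 0 < nearestDist φ) :
    Measure.infinitePi (fun _ : ℕ => c.markLaw) {m | ENNReal.ofReal γ <
      ENNReal.ofReal (c.signal (nearestDist φ) (m (nearestIdx φ))) / c.noisyInterference (φ, m)} =
      ∫⁻ m, c.condCoverage γ (φ, m) ∂Measure.infinitePi (fun _ : ℕ => c.markLaw) := by
  have hγt : ENNReal.ofReal c.γt⁻¹ ≠ 0 := by simpa using c.γt_pos
  have hset : MeasurableSet {z : Mark × ℝ≥0∞ | ENNReal.ofReal γ <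
      ENNReal.ofReal (c.signal (nearestDist φ) z.1) / (z.2 + ENNReal.ofReal c.γt⁻¹)} := by
    refine measurableSet_lt measurable_const (Measurable.div ?_ (by fun_prop))
    exact (c.measurable_signal.comp (f := fun z : Mark × ℝ≥0∞ => (nearestDist φ, z.1))
      (by fun_prop)).ennreal_ofReal
  have hmain := lintegral_infinitePi_eval_tsum (μ := c.markLaw)
    (a := fun k m => ENNReal.ofReal (c.interference ‖φ k‖ m))
    (fun k => (c.measurable_interference.comp
      (measurable_const.prodMk measurable_id)).ennreal_ofReal) (nearestIdx φ)
    (measurable_one.indicator hset)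
  have hm := measurable_prodMk_left (x := φ) (c.measurableSet_coverage γ)
  refine (lintegral_indicator_one hm).symm.trans (hmain.trans (lintegral_congr fun m => ?_))
  rw [condCoverage, ← c.markLaw_signal h0 hγ (D := c.noisyInterference (φ, m))
    (by simp [noisyInterference, hγt])]
  exact lintegral_indicator_one (measurable_prodMk_right hset)

theorem IsNetwork.measure_coverage {Ω : Type*} [MeasurableSpace Ω] {Pr : Measure Ω}
    [IsProbabilityMeasure Pr] {Φ : ℕ → Ω → Plane} {M : ℕ → Ω → Mark} {c : Params}
    (h : c.IsNetwork Φ M Pr) {γ : ℝ} (hγ : 0 < γ) :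
    Pr {ω | ENNReal.ofReal γ < c.sinr Φ M ω} = ∫⁻ q, c.condCoverage γ q
      ∂(Pr.map fun ω k => Φ k ω).prod (Measure.infinitePi fun _ => c.markLaw) := by
  have hS := c.measurableSet_coverage γ
  have h1 : Pr {ω | ENNReal.ofReal γ < c.sinr Φ M ω} =
      (Pr.map fun ω => ((fun k => Φ k ω, fun k => M k ω) : (ℕ → Plane) × (ℕ → Mark)))
        {q | ENNReal.ofReal γ < ENNReal.ofReal (c.signal (nearestDist q.1) (q.2 (nearestIdx q.1))) /
          c.noisyInterference q} :=
    (Measure.map_apply_of_aemeasurable h.hasLaw.aemeasurable hS).symm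
  have hmeas := c.measurable_condCoverage γ
  rw [h1, h.hasLaw.map_eq, Measure.prod_apply hS,
    lintegral_map (measurable_measure_prodMk_left hS) h.measurable_points,
    lintegral_prod _ hmeas.aemeasurable,
    lintegral_map (Measurable.lintegral_prod_right' hmeas) h.measurable_points]
  exact lintegral_congr_ae (h.ae_nearest.mono fun ω hω => c.infinitePi_markLaw_coverage hγ hω.1)

theorem erfcTerm_nonneg (x y : ℝ) : 0 ≤ erfcTerm x y := by
  have : 0 ≤ erfc (y / (2 * √x)) :=
    mul_nonneg (by positivity) (integral_nonneg fun _ => (Real.exp_pos _).le)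
  unfold erfcTerm
  positivity

theorem IsNetwork.lintegral_expNeg_Xstar {Ω : Type*} [MeasurableSpace Ω] {Pr : Measure Ω}
    [IsProbabilityMeasure Pr] {Φ : ℕ → Ω → Plane} {M : ℕ → Ω → Mark} {c : Params}
    (h : c.IsNetwork Φ M Pr) (hα : c.α = 4) {γ : ℝ} (hγ : 0 < γ) :
    ∫⁻ q, expNeg (ENNReal.ofReal (γ / c.etaG (nearestDist q.1)) * c.noisyInterference q)
        ∂(Pr.map fun ω k => Φ k ω).prod (Measure.infinitePi fun _ => c.markLaw) =
      ENNReal.ofReal (Real.pi * c.lam / 2 * c.Xstar γ) := by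
  rw [h.lintegral_noisyInterference hα hγ, Xstar, X₃, X₄, mul_comm c.e₁]

/-- The Laplace variable is absorbed into the threshold: `b = s γ / χ̄`. -/
theorem IsNetwork.lintegral_expNeg_Xplus {Ω : Type*} [MeasurableSpace Ω] {Pr : Measure Ω}
    [IsProbabilityMeasure Pr] {Φ : ℕ → Ω → Plane} {M : ℕ → Ω → Mark} {c : Params}
    (h : c.IsNetwork Φ M Pr) (hα : c.α = 4) {γ : ℝ} (hγ : 0 < γ) {s : ℝ} (hs : 0 < s) :
    ∫⁻ q, expNeg (ENNReal.ofReal s * (ENNReal.ofReal (γ / c.χbar / c.etaG (nearestDist q.1)) *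
        c.noisyInterference q))
        ∂(Pr.map fun ω k => Φ k ω).prod (Measure.infinitePi fun _ => c.markLaw) =
      ENNReal.ofReal (Real.pi * c.lam / 2 * c.Xplus γ s) := by
  have hχ := c.χbar_pos
  have hCd := c.Cd_pos
  have hb : 0 < s * γ / c.χbar := by positivity
  simp_rw [← mul_assoc, ← ENNReal.ofReal_mul hs.le, ← mul_div_assoc s]
  rw [h.lintegral_noisyInterference hα hb, Xplus, X₁, X₂]
  congr 3
  · field_simp
  · congr 3
    · congr 1
      field_simp
    · congr 1
      field_simp

end Params

end RISCoverage

end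

theorem corollary2 (c : RISCoverage.Params) (hα : c.α = 4)
    {Ω : Type*} [MeasurableSpace Ω] (Pr : Measure Ω) [IsProbabilityMeasure Pr]
    (Φ : ℕ → Ω → RISCoverage.Plane) (M : ℕ → Ω → RISCoverage.Params.Mark)
    (hnet : c.IsNetwork Φ M Pr) (γ : ℝ) (hγ : 0 < γ) :
    ContDiffAt ℝ (⊤ : ℕ∞) (c.Xplus γ) 1 ∧
    c.coverage Φ M Pr γ =
      Real.pi * c.lam * c.p / 2 *
          ∑ i ∈ Finset.range c.κhat,
            (-1 : ℝ) ^ i / (Nat.factorial i : ℝ) * iteratedDeriv i (c.Xplus γ) 1 +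
        Real.pi * c.lam * (1 - c.p) / 2 * c.Xstar γ := by
  have hK : 0 < Real.pi * c.lam / 2 := by
    have := c.lam_pos
    positivity
  have hp0 := c.p_mem.1
  have hp1 : 0 ≤ 1 - c.p := by linarith [c.p_mem.2]
  have : IsProbabilityMeasure (Pr.map fun ω k => Φ k ω) :=
    Measure.isProbabilityMeasure_map hnet.measurable_points.aemeasurable
  have hT := c.measurable_mul_noisyInterference (γ / c.χbar)
  obtain ⟨hsmooth, hderiv⟩ := RISCoverage.laplace_derivatives hT
    (f := fun s => Real.pi * c.lam / 2 * c.Xplus γ s)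
    (fun s _ => mul_nonneg hK.le (RISCoverage.Params.erfcTerm_nonneg _ _))
    (fun s hs => hnet.lintegral_expNeg_Xplus hα hγ hs)
  have hX : ContDiffAt ℝ (⊤ : ℕ∞) (c.Xplus γ) 1 :=
    (hsmooth.const_smul (Real.pi * c.lam / 2)⁻¹).congr_of_eventuallyEq
      (Filter.Eventually.of_forall fun s => (inv_mul_cancel_left₀ hK.ne' _).symm)
  have hX_deriv : ∀ i, iteratedDeriv i (fun s => Real.pi * c.lam / 2 * c.Xplus γ s) 1 =
      Real.pi * c.lam / 2 * iteratedDeriv i (c.Xplus γ) 1 := fun i =>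
    iteratedDeriv_const_mul _ (hX.of_le (by exact_mod_cast le_top))
  refine ⟨hX, ?_⟩
  have hstar0 : 0 ≤ Real.pi * c.lam / 2 * c.Xstar γ :=
    mul_nonneg hK.le (RISCoverage.Params.erfcTerm_nonneg _ _)
  -- Each signed derivative is the mean of a nonnegative variable, so the sum can be moved through
  -- `ENNReal.ofReal` term by term despite the alternating signs.
  have hterm : ∀ i, 0 ≤ (i.factorial : ℝ)⁻¹ *
      ((-1) ^ i * (Real.pi * c.lam / 2 * iteratedDeriv i (c.Xplus γ) 1)) := fun i =>
    mul_nonneg (by positivity) (hX_deriv i ▸ (hderiv i).1)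
  have hsum0 := Finset.sum_nonneg (s := Finset.range c.κhat) fun i _ => hterm i
  have hcov : Pr {ω | ENNReal.ofReal γ < c.sinr Φ M ω} = ENNReal.ofReal
      (c.p * (∑ i ∈ Finset.range c.κhat, (i.factorial : ℝ)⁻¹ *
        ((-1) ^ i * (Real.pi * c.lam / 2 * iteratedDeriv i (c.Xplus γ) 1))) +
        (1 - c.p) * (Real.pi * c.lam / 2 * c.Xstar γ)) := by
    have hi : ∀ i : ℕ, Measurable fun q : (ℕ → RISCoverage.Plane) × (ℕ → RISCoverage.Params.Mark) =>
        (ENNReal.ofReal (γ / c.χbar / c.etaG (RISCoverage.Params.nearestDist q.1)) *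
          c.noisyInterference q) ^ i * RISCoverage.expNeg (ENNReal.ofReal
        (γ / c.χbar / c.etaG (RISCoverage.Params.nearestDist q.1)) * c.noisyInterference q) :=
      fun i => (hT.pow_const i).mul (c.measurable_expNeg_mul_noisyInterference (γ / c.χbar))
    rw [hnet.measure_coverage hγ]
    unfold RISCoverage.Params.condCoverage RISCoverage.gammaTail
    rw [lintegral_add_left ((Finset.measurable_sum _ fun i _ => (hi i).const_mul _).const_mul _),
      lintegral_const_mul _ (Finset.measurable_sum _ fun i _ => (hi i).const_mul _),
      lintegral_finsetSum _ fun i _ => (hi i).const_mul _,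
      lintegral_const_mul _ (c.measurable_expNeg_mul_noisyInterference γ),
      hnet.lintegral_expNeg_Xstar hα hγ, ENNReal.ofReal_add (mul_nonneg hp0 hsum0)
        (mul_nonneg hp1 hstar0), ENNReal.ofReal_mul hp0, ENNReal.ofReal_mul hp1,
      ENNReal.ofReal_sum_of_nonneg fun i _ => hterm i]
    congr 2
    refine Finset.sum_congr rfl fun i _ => ?_
    rw [lintegral_const_mul _ (hi i), ENNReal.ofReal_mul (by positivity), ← hX_deriv]
    congr 1
    exact (hderiv i).2
  rw [RISCoverage.Params.coverage, Measure.real, hcov, ENNReal.toReal_ofReal (add_nonneg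
    (mul_nonneg hp0 hsum0) (mul_nonneg hp1 hstar0)), Finset.mul_sum, Finset.mul_sum]
  congr 1
  · refine Finset.sum_congr rfl fun i _ => ?_
    ring
  · ring
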